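/- **Conventions.** $D(U)$ is the set of finitely supported probability distributions on a set $U$, and $D(Y)$, for a simplicial set $Y$, is the simplicial set with $n$-simplices $D(Y_n)$ and push-forward structure maps. $N\mathbb Z_2$ is the nerve of $\mathbb Z_2$, with $n$-simplices $\mathbb Z_2^n$. For a simplicial set $Z$, $\mathrm{sDist}(Z)$ is the set of simplicial set maps $p: Z\to D(N\mathbb Z_2)$; $p_\sigma$ denotes the value of $p$ at $\sigma$, and $p_\sigma^a$ the probability it gives to $a$. A simplicial set map $s:Z\to N\mathbb Z_2$ defines the deterministic distribution $\delta^s\in \mathrm{dDist}(Z)\subset \mathrm{sDist}(Z)$, $(\delta^s)_\sigma=\delta^{s_\sigma}$. A distribution $p$ is non-contextual if there is a finitely supported probability distribution $d$ on the set of maps $s:Z\to N\mathbb Z_2$ with $p_\sigma=\sum_s d(s)\,\delta^{s_\sigma}$ for every simplex $\sigma$, and contextual otherwise. A vertex is an extreme point of the convex set $\mathrm{sDist}(Z)$. The product is $(p\cdot q)_\sigma^a=\sum_{b+c=a}p_\sigma^b q_\sigma^c$. Let $X$ be a $1$-dimensional simplicial set in which every vertex is an end point of a non-degenerate edge, let $X_1^\circ$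 be the set of its non-degenerate edges, and let $\mathrm{Cone}(X)$ be its cone, with apex $c$ and triangles $(c,\tau)$ for $\tau\in X_1^\circ$ (with $d_0(c,\tau)=\tau$, $d_1(c,\tau)=(c,d_0\tau)$, $d_2(c,\tau)=(c,d_1\tau)$). Let $p_+$ and $p_-$ be the distributions on $\mathbb Z_2^2$ with $p_+^{00}=p_+^{10}=\tfrac12$ and $p_-^{01}=p_-^{11}=\tfrac12$. Let $G_\pm(\mathrm{Cone}\,X)$ be the set of $p\in\mathrm{sDist}(\mathrm{Cone}\,X)$ with $p_{(c,\tau)}\in\{p_+,p_-\}$ for every $\tau\in X_1^\circ$. **Statement.** There is a unique $e_+\in \mathrm{sDist}(\mathrm{Cone}\,X)$ with $(e_+)_{(c,\tau)}=p_+$ for all $\tau\in X_1^\circ$. Under the product above $G_\pm(\mathrm{Cone}\,X)$ is an abelian group with identity $e_+$, isomorphic to $\mathbb Z_2^{X_1^\circ}$, and $$e_+\cdot \mathrm{dDist}(\mathrm{Cone}\,X)=\{e_+\cdot\delta^s : \delta^s\in\mathrm{dDist}(\mathrm{Cone}\,X)\}$$ is a subgroup of it. An element of $G_\pm(\mathrm{Cone}\,X)$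 is non-contextual if and only if it lies in $e_+\cdot \mathrm{dDist}(\mathrm{Cone}\,X)$. Suppose moreover that $X$ is connected. Then every element of $G_\pm(\mathrm{Cone}\,X)\setminus \big(e_+\cdot \mathrm{dDist}(\mathrm{Cone}\,X)\big)$ is a contextual vertex of $\mathrm{sDist}(\mathrm{Cone}\,X)$. For every maximal (that is, spanning) tree $T\subset X$, with collapsing map $\pi:X\to X/T$, these elements are exactly the distributions $\delta^s\cdot(\mathrm{Cone}\,\pi)^*(q)$, where $(\mathrm{Cone}\,\pi)^*(q)=q\circ \mathrm{Cone}\,\pi$, $\delta^s\in \mathrm{dDist}(\mathrm{Cone}\,X)$ and $q$ is a contextual vertex of $\mathrm{sDist}(\mathrm{Cone}(X/T))$. If $X$ is finite, their number is $(2^{n_X}-1)\,2^{|X_0|-1}$, where $n_X$ is the number of non-degenerate edges of $X$ outside $T$ (the rank of the free group $\pi_1(X)$). -/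

import Mathlib

open CategoryTheory Opposite Convexity

namespace SimplicialContextuality

/-! ### Simplices of the cone -/

section ConeSimplices

universe u

/-- The `n`-simplices of the cone: `{c_n} ⊔ X_n ⊔ ⨆_{k+1+l=n} {c_k} × X_l`. -/
inductive ConeSimplex (X : SSet.{u}) (n : SimplexCategory) : Type u where
  | apex : ConeSimplex X n
  | base (σ : X.obj (op n)) : ConeSimplex X n
  | join (k l : ℕ) (h : k + 1 + l = n.len) (σ : X.obj (op (SimplexCategory.mk l))) : ConeSimplex X n

/-- For an operator `f : [m] → [n]`, the number of vertices of `[m]` sent to the vertices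
`0, …, k` of `[n]`; these are the first ones. -/
def coneCut {m n : SimplexCategory} (f : m ⟶ n) (k : ℕ) : ℕ :=
  (Finset.univ.filter fun i : Fin (m.len + 1) => (f i).val ≤ k).card

/-- The operator `[r] → [l]` given by `i ↦ f(i + j) - (k + 1)`. It is used where `j = coneCut f k`,
`i + j ≤ m` and `f(i + j) ≤ k + 1 + l`, so that the truncations (`min`) have no effect. -/
def coneTail {m n : SimplexCategory} (f : m ⟶ n) (k l j r : ℕ) : SimplexCategory.mk r ⟶ SimplexCategory.mk l :=
  SimplexCategory.mkHom
    { toFun := fun i => ⟨min ((f ⟨min (i.val + j) m.len, by omega⟩).val - (k + 1)) l, by omega⟩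
      monotone' := fun a b hab => by
        have h1 : (f ⟨min (a.val + j) m.len, by omega⟩).val
            ≤ (f ⟨min (b.val + j) m.len, by omega⟩).val := by
          apply f.toOrderHom.monotone
          have : a.val ≤ b.val := hab
          simp only [Fin.mk_le_mk]
          omega
        simp only [Fin.mk_le_mk]
        omega }

/-- The action of an operator `f : [m] → [n]` on the cone. For a simplex `(c_k, σ)` with
`σ ∈ X_l`, the first `j = coneCut f k` vertices of `[m]` go to the apex, the other ones to `σ`. -/
def coneAct (X : SSet.{u}) {m n : SimplexCategory} (f : m ⟶ n) :
    ConeSimplex X n → ConeSimplex X m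
  | .apex => .apex
  | .base σ => .base (X.map f.op σ)
  | .join k l _ σ =>
    if h0 : coneCut f k = 0 then .base (X.map (coneTail f k l 0 m.len).op σ)
    else if h1 : m.len < coneCut f k then .apex
    else .join (coneCut f k - 1) (m.len - coneCut f k) (by omega)
      (X.map (coneTail f k l (coneCut f k) (m.len - coneCut f k)).op σ)

/-- The map induced by `φ : X ⟶ X'` on simplices of the cones. -/
def coneMapFun {X X' : SSet.{u}} (φ : X ⟶ X') (n : SimplexCategory) :
    ConeSimplex X n → ConeSimplex X' n
  | .apex => .apex
  | .base σ => .base (φ.app (op n) σ)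
  | .join k l h σ => .join k l h (φ.app (op (SimplexCategory.mk l)) σ)

end ConeSimplices

/-! ### Simplicial distributions -/

section Distributions

open Simplicial

universe u

/-- The simplicial set `D_R(Y)` of distributions on `Y`, for `R` the non-negative reals: its
`n`-simplices are the finitely supported probability distributions on `Y_n`, and the simplicial
operators act by push-forward. -/
noncomputable def distSSet (Y : SSet.{u}) : SSet.{u} where
  obj n := StdSimplex ℝ (Y.obj n)
  map f := ↾(fun p => p.map (Y.map f))
  map_id n := by
    refine ConcreteCategory.hom_ext _ _ fun p => ?_
    change p.map (Y.map (𝟙 n)) = p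
    rw [CategoryTheory.Functor.map_id]
    exact StdSimplex.map_id p
  map_comp f g := by
    refine ConcreteCategory.hom_ext _ _ fun p => ?_
    change p.map (Y.map (f ≫ g)) = (p.map (Y.map f)).map (Y.map g)
    rw [CategoryTheory.Functor.map_comp]
    exact StdSimplex.map_comp p (Y.map f) (Y.map g)

/-- The canonical map `δ : Y ⟶ D_R(Y)` sending a simplex to the delta distribution at it. -/
noncomputable def delta (Y : SSet.{u}) : Y ⟶ distSSet Y where
  app n := ↾(fun y => (StdSimplex.single y : StdSimplex ℝ (Y.obj n)))
  naturality m n f := by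
    refine ConcreteCategory.hom_ext _ _ fun y => ?_
    exact (StdSimplex.map_single y (Y.map f)).symm

/-- `sDist(X, Y)`: simplicial distributions on the scenario `(X, Y)`. -/
abbrev SDist (X Y : SSet.{u}) : Type u := X ⟶ distSSet Y

variable {X X' Y : SSet.{u}}

/-- The distribution `p_σ` on `Y_n` attached to an `n`-simplex `σ` of `X`. -/
noncomputable def SDist.at (p : SDist X Y) {n : ℕ} (σ : X _⦋n⦌) : StdSimplex ℝ (Y _⦋n⦌) :=
  p.app (op ⦋n⦌) σ

/-- The deterministic distribution `δ^s` of an outcome assignment `s : X ⟶ Y`. -/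
noncomputable def SDist.det (s : X ⟶ Y) : SDist X Y := s ≫ delta Y

/-- The pull-back `f^*` of simplicial distributions along a map of measurement spaces. -/
noncomputable def SDist.pullback (f : X' ⟶ X) (p : SDist X Y) : SDist X' Y := f ≫ p

/-- The map `Θ`, sending `d = ∑ d(s) δ^s` to the simplicial distribution
`σ ↦ ∑ d(s) δ^{s_σ}`, that is, to the push-forwards of `d` along `s ↦ s_σ`. -/
noncomputable def Theta (d : StdSimplex ℝ (X ⟶ Y)) : SDist X Y where
  app n := ↾(fun σ => (d.map (fun s => s.app n σ) : StdSimplex ℝ (Y.obj n)))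
  naturality m n f := by
    refine ConcreteCategory.hom_ext _ _ fun σ => ?_
    refine Eq.trans ?_ (StdSimplex.map_map d (fun s => s.app m σ) (Y.map f)).symm
    change d.map (fun s => s.app n (X.map f σ)) = _
    congr 1
    funext s
    exact NatTrans.naturality_apply s f σ

/-- A simplicial distribution is non-contextual if it is in the image of `Θ`. -/
def SDist.NonContextual (p : SDist X Y) : Prop := p ∈ Set.range (Theta (X := X) (Y := Y))

/-- A simplicial distribution is contextual if it is not non-contextual. -/
def SDist.Contextual (p : SDist X Y) : Prop := ¬ p.NonContextual

/-- The probabilities `p_σ(y)`, as a point of a real vector space of functions. -/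
noncomputable def SDist.prob (p : SDist X Y) : (Σ n : ℕ, X _⦋n⦌ × Y _⦋n⦌) → ℝ :=
  fun x => (p.at x.2.1).weights x.2.2

/-- `p` is a vertex, that is, an extreme point of the convex set `sDist(X, Y)`. -/
def SDist.IsVertex (p : SDist X Y) : Prop :=
  p.prob ∈ Set.extremePoints ℝ (Set.range (SDist.prob (X := X) (Y := Y)))

end Distributions

/-! ### The nerve of `ℤ/2` and the product of simplicial distributions -/

section Nerve

open Simplicial

/-- The action of a simplicial operator on the nerve of `ℤ/2`: consecutive entries are added up. -/
def nerveMap {m n : SimplexCategory} (f : m ⟶ n) (a : Fin n.len → ZMod 2) : Fin m.len → ZMod 2 :=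
  fun i => ∑ j : Fin n.len with
    (f i.castSucc).val ≤ j.val ∧ j.val < (f i.succ).val, a j

theorem nerveMap_add {m n : SimplexCategory} (f : m ⟶ n) (a b : Fin n.len → ZMod 2) :
    nerveMap f (a + b) = nerveMap f a + nerveMap f b := by
  funext i
  simp [nerveMap, Finset.sum_add_distrib]

/-- Partial sums of a sequence. -/
def partialSum {n : ℕ} (a : Fin n → ZMod 2) (t : ℕ) : ZMod 2 :=
  ∑ j : Fin n with j.val < t, a j

theorem sum_Ico_eq {n : ℕ} (a : Fin n → ZMod 2) {s t : ℕ} (h : s ≤ t) :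
    (∑ j : Fin n with s ≤ j.val ∧ j.val < t, a j) = partialSum a t - partialSum a s := by
  rw [eq_sub_iff_add_eq, partialSum, partialSum, ← Finset.sum_union]
  · congr 1
    ext j
    simp only [Finset.mem_union, Finset.mem_filter, Finset.mem_univ, true_and]
    omega
  · rw [Finset.disjoint_filter]
    intro j _ h1
    omega

theorem nerveMap_apply {m n : SimplexCategory} (f : m ⟶ n) (a : Fin n.len → ZMod 2)
    (i : Fin m.len) :
    nerveMap f a i = partialSum a (f i.succ).val - partialSum a (f i.castSucc).val :=
  sum_Ico_eq a (f.toOrderHom.monotone (Fin.castSucc_le_succ i))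

theorem partialSum_succ {n : ℕ} (a : Fin n → ZMod 2) {t : ℕ} (h : t < n) :
    partialSum a (t + 1) = partialSum a t + a ⟨t, h⟩ := by
  have := sum_Ico_eq a (Nat.le_succ t)
  have h2 : (Finset.univ.filter fun j : Fin n => t ≤ j.val ∧ j.val < t.succ) = {⟨t, h⟩} := by
    ext j
    simp only [Finset.mem_filter, Finset.mem_univ, true_and, Finset.mem_singleton, Fin.ext_iff]
    omega
  rw [h2, Finset.sum_singleton] at this
  rw [this]
  ring

theorem partialSum_zero {n : ℕ} (a : Fin n → ZMod 2) : partialSum a 0 = 0 := by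
  simp [partialSum]

theorem partialSum_nerveMap {m n : SimplexCategory} (f : m ⟶ n) (a : Fin n.len → ZMod 2) (t : ℕ)
    (ht : t < m.len + 1) :
    partialSum (nerveMap f a) t = partialSum a (f ⟨t, ht⟩).val - partialSum a (f 0).val := by
  induction t with
  | zero => simp [partialSum_zero]
  | succ t ih =>
    rw [partialSum_succ _ (by omega : t < m.len), ih (by omega), nerveMap_apply]
    simp only [Fin.succ_mk, Fin.castSucc_mk]
    ring

/-- The nerve space `Nℤ₂`: its `n`-simplices are the `n`-tuples in `ℤ₂`; the inner face maps add
neighbouring entries, the outer ones drop an entry, and the degeneracies insert a `0`. -/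
def NZ2 : SSet.{0} where
  obj n := Fin n.unop.len → ZMod 2
  map f := ↾(nerveMap f.unop)
  map_id n := by
    refine ConcreteCategory.hom_ext _ _ fun a => ?_
    funext i
    change nerveMap (𝟙 n.unop) a i = a i
    rw [nerveMap_apply]
    change partialSum a (i.val + 1) - partialSum a i.val = a i
    rw [partialSum_succ a i.isLt]
    simp
  map_comp {k m n} f g := by
    refine ConcreteCategory.hom_ext _ _ fun a => ?_
    funext i
    change nerveMap (g.unop ≫ f.unop) a i = nerveMap g.unop (nerveMap f.unop a) i
    rw [nerveMap_apply, nerveMap_apply, partialSum_nerveMap _ _ _ (Fin.isLt _),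
      partialSum_nerveMap _ _ _ (Fin.isLt _)]
    simp

/-- The convolution of two distributions on an additive group:
`(p * q)(a) = ∑_{b + c = a} p(b) q(c)`, the push-forward of `p × q` along addition. -/
noncomputable def conv {A : Type*} [AddCommGroup A] (p q : StdSimplex ℝ A) : StdSimplex ℝ A :=
  iConvexComb p (fun b => q.map (fun c => b + c))

theorem conv_weights {A : Type*} [AddCommGroup A] [Fintype A] (p q : StdSimplex ℝ A) (a : A) :
    (conv p q).weights a = ∑ b : A, p.weights b * q.weights (a - b) := by
  rw [conv, StdSimplex.weights_iConvexComb, Finsupp.sum_fintype _ _ (by simp), Finsupp.finsetSum_apply]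
  refine Finset.sum_congr rfl fun b _ => ?_
  rw [Finsupp.smul_apply, smul_eq_mul, StdSimplex.weights_map]
  congr 1
  have := Finsupp.mapDomain_apply (add_right_injective b) q.weights (a - b)
  simpa using this

theorem conv_map {A B : Type*} [AddCommGroup A] [AddCommGroup B] (f : A → B)
    (hf : ∀ a b, f (a + b) = f a + f b) (p q : StdSimplex ℝ A) :
    (conv p q).map f = conv (p.map f) (q.map f) := by
  simp only [conv, iConvexComb, StdSimplex.map_sConvexComb, StdSimplex.map_map, hf]

noncomputable instance (n : SimplexCategoryᵒᵖ) : AddCommGroup (NZ2.obj n) :=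
  inferInstanceAs (AddCommGroup (Fin n.unop.len → ZMod 2))

/-- The product of simplicial distributions with outcomes in `Nℤ₂`:
`(p · q)_σ^a = ∑_{b + c = a} p_σ^b q_σ^c`. -/
noncomputable def SDist.mul {X : SSet.{0}} (p q : SDist X NZ2) : SDist X NZ2 where
  app n := ↾(fun σ => (conv (p.app n σ : StdSimplex ℝ (NZ2.obj n)) (q.app n σ)))
  naturality m n f := by
    refine ConcreteCategory.hom_ext _ _ fun σ => ?_
    have hp := NatTrans.naturality_apply p f σ
    have hq := NatTrans.naturality_apply q f σ
    change conv (p.app n (X.map f σ)) (q.app n (X.map f σ)) = (conv _ _).map (NZ2.map f)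
    rw [hp, hq]
    exact (conv_map (NZ2.map f) (nerveMap_add f.unop) _ _).symm

end Nerve

/-! ### The cone of a simplicial set -/

section Cone

open Simplicial

universe u

theorem lt_coneCut_iff {m n : SimplexCategory} (f : m ⟶ n) (k : ℕ) (i : Fin (m.len + 1)) :
    i.val < coneCut f k ↔ (f i).val ≤ k := by
  have hmono : ∀ a b : Fin (m.len + 1), a ≤ b → (f a).val ≤ (f b).val :=
    fun a b h => f.toOrderHom.monotone h
  constructor
  · intro h
    by_contra hc
    have : (Finset.univ.filter fun i : Fin (m.len + 1) => (f i).val ≤ k) ⊆ Finset.Iio i := by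
      intro a ha
      simp only [Finset.mem_filter, Finset.mem_univ, true_and] at ha
      rw [Finset.mem_Iio]
      by_contra hai
      have := hmono i a (not_lt.mp hai)
      omega
    have := Finset.card_le_card this
    rw [Fin.card_Iio] at this
    unfold coneCut at h
    omega
  · intro h
    have : Finset.Iic i ⊆ (Finset.univ.filter fun i : Fin (m.len + 1) => (f i).val ≤ k) := by
      intro a ha
      simp only [Finset.mem_filter, Finset.mem_univ, true_and]
      exact (hmono a i (Finset.mem_Iic.mp ha)).trans h
    have := Finset.card_le_card this
    rw [Fin.card_Iic] at this
    unfold coneCut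
    omega

theorem coneCut_le {m n : SimplexCategory} (f : m ⟶ n) (k : ℕ) : coneCut f k ≤ m.len + 1 := by
  unfold coneCut
  refine (Finset.card_le_univ _).trans ?_
  simp

theorem coneCut_eq {m n : SimplexCategory} (f : m ⟶ n) (k j : ℕ) (hj : j ≤ m.len + 1)
    (h : ∀ i : Fin (m.len + 1), i.val < j ↔ (f i).val ≤ k) : coneCut f k = j := by
  have hc := coneCut_le f k
  rcases lt_trichotomy (coneCut f k) j with hlt | heq | hgt
  · have h1 := h ⟨coneCut f k, by omega⟩
    have h2 := lt_coneCut_iff f k ⟨coneCut f k, by omega⟩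
    simp only at h1 h2
    omega
  · exact heq
  · have h1 := h ⟨j, by omega⟩
    have h2 := lt_coneCut_iff f k ⟨j, by omega⟩
    simp only at h1 h2
    omega

theorem coneAct_join_base (X : SSet.{u}) {m n : SimplexCategory} (f : m ⟶ n) (k l : ℕ)
    (h : k + 1 + l = n.len) (σ : X _⦋l⦌) (g : m ⟶ ⦋l⦌)
    (hg : ∀ i : Fin (m.len + 1), (f i).val = k + 1 + (g i).val) :
    coneAct X f (.join k l h σ) = .base (X.map g.op σ) := by
  have hcut : coneCut f k = 0 := by
    apply coneCut_eq _ _ _ (Nat.zero_le _)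
    intro i
    have := hg i
    omega
  have : coneTail f k l 0 m.len = g := by
    ext i
    have h1 := hg i
    have h2 : i.val < m.len + 1 := i.isLt
    have h3 : (⟨min (i.val + 0) m.len, by omega⟩ : Fin (m.len + 1)) = i := by
      ext
      simp only
      omega
    have h4 : (g i).val < l + 1 := (g i).isLt
    change min ((f ⟨min (i.val + 0) m.len, by omega⟩).val - (k + 1)) l = (g i).val
    rw [h3]
    omega
  simp only [coneAct, hcut, dite_true]
  rw [this]

theorem coneAct_join_apex (X : SSet.{u}) {m n : SimplexCategory} (f : m ⟶ n) (k l : ℕ)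
    (h : k + 1 + l = n.len) (σ : X _⦋l⦌)
    (hf : ∀ i : Fin (m.len + 1), (f i).val ≤ k) :
    coneAct X f (.join k l h σ) = .apex := by
  have hcut : coneCut f k = m.len + 1 := by
    apply coneCut_eq _ _ _ le_rfl
    intro i
    have := hf i
    have := i.isLt
    omega
  have h0 : ¬ (coneCut f k = 0) := by omega
  have h1 : m.len < coneCut f k := by omega
  simp only [coneAct, h0, h1, dite_true, dite_false]

theorem coneAct_join_join (X : SSet.{u}) {m n : SimplexCategory} (f : m ⟶ n) (k l k' l' : ℕ)
    (h : k + 1 + l = n.len) (h' : k' + 1 + l' = m.len) (σ : X _⦋l⦌) (g : ⦋l'⦌ ⟶ ⦋l⦌)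
    (hf : ∀ i : Fin (m.len + 1), i.val ≤ k' → (f i).val ≤ k)
    (hg : ∀ i : Fin (l' + 1), (f ⟨k' + 1 + i.val, by omega⟩).val = k + 1 + (g i).val) :
    coneAct X f (.join k l h σ) = .join k' l' h' (X.map g.op σ) := by
  have hcut : coneCut f k = k' + 1 := by
    apply coneCut_eq _ _ _ (by omega)
    intro i
    constructor
    · intro hi
      exact hf i (by omega)
    · intro hi
      by_contra hc
      have h1 := hg ⟨i.val - (k' + 1), by have := i.isLt; omega⟩
      have h2 : (⟨k' + 1 + (i.val - (k' + 1)), by have := i.isLt; omega⟩ : Fin (m.len + 1)) = i := by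
        ext
        simp only
        omega
      simp only [h2] at h1
      omega
  obtain rfl : l' = m.len - (k' + 1) := by omega
  have ht : coneTail f k l (k' + 1) (m.len - (k' + 1)) = g := by
    ext i
    have h1 := hg i
    have h2 : i.val < m.len - (k' + 1) + 1 := i.isLt
    have h3 : (⟨min (i.val + (k' + 1)) m.len, by omega⟩ : Fin (m.len + 1))
        = ⟨k' + 1 + i.val, by omega⟩ := by
      ext
      simp only
      omega
    have h4 : (g i).val < l + 1 := (g i).isLt
    change min ((f ⟨min (i.val + (k' + 1)) m.len, by omega⟩).val - (k + 1)) l = (g i).val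
    rw [h3]
    omega
  have key : ∀ j, j = k' + 1 → ∀ hj : j - 1 + 1 + (m.len - j) = m.len,
      (ConeSimplex.join (j - 1) (m.len - j) hj (X.map (coneTail f k l j (m.len - j)).op σ) :
        ConeSimplex X m) = .join k' (m.len - (k' + 1)) h' (X.map g.op σ) := by
    rintro _ rfl hj
    rw [ht]
    rfl
  simp only [coneAct]
  rw [dif_neg (by omega), dif_neg (by omega)]
  exact key _ hcut _

/-- Every action on a simplex `(c_k, σ)` is of one of the three kinds described above. -/
theorem cone_cases {m n : SimplexCategory} (f : m ⟶ n) (k l : ℕ) (h : k + 1 + l = n.len) :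
    (∃ g : m ⟶ ⦋l⦌, ∀ i : Fin (m.len + 1), (f i).val = k + 1 + (g i).val) ∨
    (∀ i : Fin (m.len + 1), (f i).val ≤ k) ∨
    (∃ (k' l' : ℕ) (h' : k' + 1 + l' = m.len) (g : ⦋l'⦌ ⟶ ⦋l⦌),
      (∀ i : Fin (m.len + 1), i.val ≤ k' → (f i).val ≤ k) ∧
      ∀ i : Fin (l' + 1), (f ⟨k' + 1 + i.val, by omega⟩).val = k + 1 + (g i).val) := by
  have hc := coneCut_le f k
  by_cases h0 : coneCut f k = 0
  · left
    refine ⟨coneTail f k l 0 m.len, fun i => ?_⟩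
    have h1 := lt_coneCut_iff f k i
    have h2 : i.val < m.len + 1 := i.isLt
    have h3 : (⟨min (i.val + 0) m.len, by omega⟩ : Fin (m.len + 1)) = i := by
      ext
      simp only
      omega
    have h4 : (f i).val < n.len + 1 := (f i).isLt
    change _ = k + 1 + min ((f ⟨min (i.val + 0) m.len, by omega⟩).val - (k + 1)) l
    rw [h3]
    omega
  · right
    by_cases h1 : m.len < coneCut f k
    · left
      intro i
      rw [← lt_coneCut_iff]
      have := i.isLt
      omega
    · right
      refine ⟨coneCut f k - 1, m.len - coneCut f k, by omega,
        coneTail f k l (coneCut f k) (m.len - coneCut f k), fun i hi => ?_, fun i => ?_⟩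
      · rw [← lt_coneCut_iff]
        omega
      · have h2 : i.val < m.len - coneCut f k + 1 := i.isLt
        have h3 : (⟨min (i.val + coneCut f k) m.len, by omega⟩ : Fin (m.len + 1))
            = ⟨coneCut f k - 1 + 1 + i.val, by omega⟩ := by
          ext
          simp only
          omega
        have h5 := lt_coneCut_iff f k ⟨coneCut f k - 1 + 1 + i.val, by omega⟩
        have h4 : (f ⟨coneCut f k - 1 + 1 + i.val, by omega⟩).val < n.len + 1 := Fin.isLt _
        simp only at h5
        change _ = k + 1 + min ((f ⟨min (i.val + coneCut f k) m.len, by omega⟩).val - (k + 1)) l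
        rw [h3]
        omega

theorem coneAct_id (X : SSet.{u}) (n : SimplexCategory) (x : ConeSimplex X n) :
    coneAct X (𝟙 n) x = x := by
  cases x with
  | apex => rfl
  | base σ => simp [coneAct]
  | join k l h σ =>
    rw [coneAct_join_join X (𝟙 n) k l k l h h σ (𝟙 _) (fun i hi => by simpa using hi)
      (fun i => by simp)]
    simp

theorem coneAct_comp (X : SSet.{u}) {p m n : SimplexCategory} (g : p ⟶ m) (f : m ⟶ n)
    (x : ConeSimplex X n) : coneAct X (g ≫ f) x = coneAct X g (coneAct X f x) := by
  cases x with
  | apex => rfl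
  | base σ => simp [coneAct]
  | join k l h σ =>
    rcases cone_cases f k l h with ⟨a, ha⟩ | ha | ⟨k', l', h', a, ha, hb⟩
    · rw [coneAct_join_base X f k l h σ a ha,
        coneAct_join_base X (g ≫ f) k l h σ (g ≫ a) (fun i => by simpa using ha (g i))]
      simp [coneAct]
    · rw [coneAct_join_apex X f k l h σ ha,
        coneAct_join_apex X (g ≫ f) k l h σ (fun i => by simpa using ha (g i))]
      rfl
    · rw [coneAct_join_join X f k l k' l' h h' σ a ha hb]
      rcases cone_cases g k' l' h' with ⟨b, hg⟩ | hg | ⟨k'', l'', h'', b, hg, hg'⟩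
      · rw [coneAct_join_base X g k' l' h' _ b hg,
          coneAct_join_base X (g ≫ f) k l h σ (b ≫ a) (fun i => ?_)]
        · simp
        · have h1 := hb (b i)
          have h2 : (⟨k' + 1 + (b i).val, by have : (b i).val < l' + 1 := (b i).isLt; omega⟩ :
              Fin (m.len + 1)) = g i := by
            ext
            exact (hg i).symm
          rw [h2] at h1
          simpa using h1
      · rw [coneAct_join_apex X g k' l' h' _ hg,
          coneAct_join_apex X (g ≫ f) k l h σ (fun i => ?_)]
        simpa using ha (g i) (hg i)
      · rw [coneAct_join_join X g k' l' k'' l'' h' h'' _ b hg hg',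
          coneAct_join_join X (g ≫ f) k l k'' l'' h h'' σ (b ≫ a) (fun i hi => ?_) (fun i => ?_)]
        · simp
        · simpa using ha (g i) (hg i hi)
        · have h1 := hb (b i)
          have h2 : (⟨k' + 1 + (b i).val, by have : (b i).val < l' + 1 := (b i).isLt; omega⟩ :
              Fin (m.len + 1)) = g ⟨k'' + 1 + i.val, by omega⟩ := by
            ext
            exact (hg' i).symm
          rw [h2] at h1
          simpa using h1

/-- The cone of a simplicial set. -/
def cone (X : SSet.{u}) : SSet.{u} where
  obj n := ConeSimplex X n.unop
  map f := ↾(coneAct X f.unop)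
  map_id n := by
    refine ConcreteCategory.hom_ext _ _ fun x => ?_
    exact coneAct_id X n.unop x
  map_comp f g := by
    refine ConcreteCategory.hom_ext _ _ fun x => ?_
    exact coneAct_comp X g.unop f.unop x

/-- Functoriality of the cone. -/
def coneMap {X X' : SSet.{u}} (φ : X ⟶ X') : cone X ⟶ cone X' where
  app n := ↾(coneMapFun φ n.unop)
  naturality n m f := by
    refine ConcreteCategory.hom_ext _ _ fun x => ?_
    change coneMapFun φ m.unop (coneAct X f.unop x) = coneAct X' f.unop (coneMapFun φ n.unop x)
    cases x with
    | apex => rfl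
    | base σ =>
      simp only [coneMapFun, coneAct]
      congr 1
      exact NatTrans.naturality_apply φ f.unop.op σ
    | join k l h σ =>
      simp only [coneMapFun, coneAct]
      split_ifs
      · simp only
        congr 1
        exact NatTrans.naturality_apply φ _ σ
      · rfl
      · simp only
        congr 1
        exact NatTrans.naturality_apply φ _ σ

/-- The triangle `(c, τ)` of the cone on an edge `τ`. -/
def coneTriangle {X : SSet.{u}} (τ : X _⦋1⦌) : (cone X) _⦋2⦌ :=
  ConeSimplex.join 0 1 rfl τ

end Cone

/-! ### Graphs, maximal trees and collapsing -/

section Graphs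

open Simplicial

universe u

/-- The simple graph underlying a simplicial set: distinct vertices are adjacent when they are the
end points of an edge. -/
def underlyingGraph (X : SSet.{u}) : SimpleGraph (X _⦋0⦌) :=
  SimpleGraph.fromRel fun v w => ∃ τ : X _⦋1⦌, X.δ 1 τ = v ∧ X.δ 0 τ = w

/-- A simplicial set is a tree: it is at most one-dimensional, has no loops and no parallel
edges, and its underlying graph is a tree. -/
def IsTree (X : SSet.{u}) : Prop :=
  X.HasDimensionLE 1 ∧
  (∀ τ ∈ X.nonDegenerate 1, X.δ 1 τ ≠ X.δ 0 τ) ∧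
  (∀ τ ∈ X.nonDegenerate 1, ∀ τ' ∈ X.nonDegenerate 1,
    s(X.δ 1 τ, X.δ 0 τ) = s(X.δ 1 τ', X.δ 0 τ') → τ = τ') ∧
  (underlyingGraph X).IsTree

/-- A maximal tree in `X`: a simplicial subset that is a tree and contains all the vertices. -/
def IsMaximalTree {X : SSet.{u}} (T : X.Subcomplex) : Prop :=
  IsTree T.toSSet ∧ ∀ v : X _⦋0⦌, v ∈ T.obj (op ⦋0⦌)

/-- The quotient `X/T` of a simplicial set by a simplicial subset: in each dimension the simplices
of `T` are identified with each other. -/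
def collapse {X : SSet.{u}} (T : X.Subcomplex) : SSet.{u} where
  obj n := Quot fun a b : X.obj n => a ∈ T.obj n ∧ b ∈ T.obj n
  map f := ↾(Quot.map (X.map f) fun _ _ h => ⟨T.map f h.1, T.map f h.2⟩)
  map_id n := by
    refine ConcreteCategory.hom_ext _ _ fun x => ?_
    induction x using Quot.ind
    simp [Quot.map]
  map_comp f g := by
    refine ConcreteCategory.hom_ext _ _ fun x => ?_
    induction x using Quot.ind
    simp [Quot.map]

/-- The collapsing map `π : X ⟶ X/T`. -/
def collapseMap {X : SSet.{u}} (T : X.Subcomplex) : X ⟶ collapse T where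
  app n := ↾(Quot.mk _)

end Graphs

/-! ### The group `G_±` and the detected contextual vertices -/

section GPM

open Simplicial

/-- `p_+`: the outcomes `(0,0)` and `(1,0)` have probability `1/2` each. -/
noncomputable def pPlus : StdSimplex ℝ (NZ2 _⦋2⦌) :=
  StdSimplex.duple (![0, 0] : Fin 2 → ZMod 2) (![1, 0] : Fin 2 → ZMod 2)
    (s := 1 / 2) (t := 1 / 2) (by norm_num) (by norm_num) (by norm_num)

/-- `p_-`: the outcomes `(0,1)` and `(1,1)` have probability `1/2` each. -/
noncomputable def pMinus : StdSimplex ℝ (NZ2 _⦋2⦌) :=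
  StdSimplex.duple (![0, 1] : Fin 2 → ZMod 2) (![1, 1] : Fin 2 → ZMod 2)
    (s := 1 / 2) (t := 1 / 2) (by norm_num) (by norm_num) (by norm_num)

/-- `G_±`: the simplicial distributions on the cone of `X` that are `p_+` or `p_-` on each of the
triangles `(c, τ)`, for `τ` a non-degenerate edge. -/
def GPM (X : SSet.{0}) : Set (SDist (cone X) NZ2) :=
  {p | ∀ τ ∈ X.nonDegenerate 1, p.at (coneTriangle τ) = pPlus ∨ p.at (coneTriangle τ) = pMinus}

/-- The coset `e · dDist(Cone X)`. -/
def detOrbit {X : SSet.{0}} (e : SDist (cone X) NZ2) : Set (SDist (cone X) NZ2) :=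
  {p | ∃ s : cone X ⟶ NZ2, p = e.mul (SDist.det s)}

/-- The distributions obtained from the contextual vertices on the cone of `X/T` by pulling them
back along the collapsing map and acting with the deterministic distributions. -/
def detectedVertices {X : SSet.{0}} (T : X.Subcomplex) : Set (SDist (cone X) NZ2) :=
  {p | ∃ (s : cone X ⟶ NZ2) (q : SDist (cone (collapse T)) NZ2),
    q.IsVertex ∧ q.Contextual ∧
      p = (SDist.det s).mul (SDist.pullback (coneMap (collapseMap T)) q)}

end GPM

end SimplicialContextuality

open SimplicialContextuality

namespace SimplicialContextuality

open Simplicial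

/-! ### Simplices of the nerve as differences of potentials -/

/-! Everything reduces to 1-cochains mod 2 on the graph `X`. A distribution in `GPM X` is fair on
the edges at the apex and deterministic on the edges of `X`, so it is `fairExt φ` for a cochain φ on
the non-degenerate edges. Every φ occurs: in dimension one there is no cocycle condition
(`ofEdges`), and the triangles fit together because the fair coin is translation invariant
(`map_coin_add`). Convolution adds cochains (`conv_fairTri`), and an outcome assignment on the cone
restricts to a coboundary on `X`, with its values at the apex edges as potential. Hence the orbit of
the identity under deterministic distributions is the group of coboundaries. These are also exactly
the non-contextual elements (`nonContextual_fairExt_iff`): any assignment in the support of a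
decomposition restricts to φ, and conversely the potentials w and w + 1, mixed equally, give the
fair extension of the coboundary of w.

Extremality (`eq_fairExt_of_mul_weights_le`): if `fairExt φ` dominates a positive multiple of q,
then q is still deterministic, equal to φ, on the base edges. Its bias g at the apex edges is
therefore transported along each edge y with sign (-1)^φ(y). For connected `X` the absolute value of
g is constant; if it were nonzero, the sign of g would be a potential for φ. So for φ not a
coboundary g vanishes and q = `fairExt φ`.

Trees: every cochain is a coboundary on `T`, so after a deterministic factor φ vanishes on `T` and
descends to `X/T`, which has a single vertex. There, every contextual vertex is fair at the apex, as
shown by comparing it with dominated distributions (`exists_eq_fairExt_of_isVertex`). The count is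
that of cochains minus coboundaries, 2^E - 2^(V-1), where E = n_X + V - 1. -/

/-- The simplex of the nerve whose entries are the increments of a potential. -/
def increments (P : ℕ → ZMod 2) (n : ℕ) : Fin n → ZMod 2 :=
  fun i => P (i.val + 1) - P i.val

theorem partialSum_increments (P : ℕ → ZMod 2) {n t : ℕ} (ht : t ≤ n) :
    partialSum (increments P n) t = P t - P 0 := by
  induction t with
  | zero => simp [partialSum_zero]
  | succ t ih =>
    rw [partialSum_succ _ (by omega : t < n), ih (by omega), increments]
    ring

/-- A simplex of the nerve is a potential on its vertices up to a constant, and an operator acts by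
reindexing the potential; `c` cancels in the differences. -/
theorem nerveMap_increments {m n : SimplexCategory} (f : m ⟶ n) (P Q : ℕ → ZMod 2) (c : ZMod 2)
    (h : ∀ i : Fin (m.len + 1), Q i.val = P (f i).val + c) :
    nerveMap f (increments P n.len) = increments Q m.len := by
  funext i
  rw [nerveMap_apply, partialSum_increments P (Nat.lt_succ_iff.1 (f i.succ).isLt),
    partialSum_increments P (Nat.lt_succ_iff.1 (f i.castSucc).isLt), increments]
  have h1 := h i.succ
  have h2 := h i.castSucc
  simp only [Fin.val_succ, Fin.val_castSucc] at h1 h2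
  rw [h1, h2]
  ring

theorem increments_partialSum {n : ℕ} (a : Fin n → ZMod 2) : increments (partialSum a) n = a := by
  funext i
  rw [increments, partialSum_succ a i.isLt]
  simp

/-! ### The fair coin -/

/-- The uniform distribution on `ℤ/2`. -/
noncomputable def coin : StdSimplex ℝ (ZMod 2) :=
  StdSimplex.duple 0 1 (s := 1 / 2) (t := 1 / 2) (by norm_num) (by norm_num) (by norm_num)

theorem duple_half_comm {A : Type*} (a b : A) :
    (StdSimplex.duple a b (s := (1 / 2 : ℝ)) (t := 1 / 2) (by norm_num) (by norm_num)
      (by norm_num)) =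
    StdSimplex.duple b a (s := (1 / 2 : ℝ)) (t := 1 / 2) (by norm_num) (by norm_num)
      (by norm_num) :=
  StdSimplex.ext (add_comm _ _)

theorem zmod_two_cases (a : ZMod 2) : a = 0 ∨ a = 1 := by
  revert a; decide

theorem map_coin {A : Type*} (f : ZMod 2 → A) : coin.map f =
    StdSimplex.duple (f 0) (f 1) (s := 1 / 2) (t := 1 / 2) (by norm_num) (by norm_num)
      (by norm_num) := by
  simp [coin]

/-- Translation invariance of the uniform distribution: this absorbs every change of base point
below. -/
theorem map_coin_add {A : Type*} (f : ZMod 2 → A) (c : ZMod 2) :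
    coin.map (fun b => f (b + c)) = coin.map f := by
  rw [map_coin, map_coin]
  rcases zmod_two_cases c with rfl | rfl
  · simp
  · rw [duple_half_comm]
    rfl

/-! ### Outcomes and distributions on simplices -/

/-- The outcomes that a map into the nerve of `ℤ/2` assigns to a simplex. -/
def outcome {Z : SSet.{0}} (φ : Z ⟶ NZ2) {n : SimplexCategory} (σ : Z.obj (op n)) :
    Fin n.len → ZMod 2 :=
  φ.app (op n) σ

theorem outcome_map {Z : SSet.{0}} (φ : Z ⟶ NZ2) {m n : SimplexCategory} (f : m ⟶ n)
    (σ : Z.obj (op n)) : outcome φ (Z.map f.op σ) = nerveMap f (outcome φ σ) :=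
  NatTrans.naturality_apply φ f.op σ

/-- The distribution that a simplicial distribution assigns to a simplex. -/
noncomputable def SDist.on {Z : SSet.{0}} (p : SDist Z NZ2) {n : SimplexCategory}
    (σ : Z.obj (op n)) : StdSimplex ℝ (Fin n.len → ZMod 2) :=
  p.app (op n) σ

theorem SDist.on_map {Z : SSet.{0}} (p : SDist Z NZ2) {m n : SimplexCategory} (f : m ⟶ n)
    (σ : Z.obj (op n)) : p.on (Z.map f.op σ) = (p.on σ).map (nerveMap f) :=
  NatTrans.naturality_apply p f.op σ

theorem SDist.ext_on {Z : SSet.{0}} {p q : SDist Z NZ2}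
    (h : ∀ (n : SimplexCategory) (σ : Z.obj (op n)), p.on σ = q.on σ) : p = q :=
  NatTrans.ext (funext fun n => ConcreteCategory.hom_ext _ _ fun σ => h n.unop σ)

/-- A simplicial distribution from a compatible family of distributions. -/
noncomputable def SDist.ofFamily {Z : SSet.{0}}
    (d : ∀ {n : SimplexCategory}, Z.obj (op n) → StdSimplex ℝ (Fin n.len → ZMod 2))
    (h : ∀ {m n : SimplexCategory} (f : m ⟶ n) (σ : Z.obj (op n)),
      d (Z.map f.op σ) = (d σ).map (nerveMap f)) : SDist Z NZ2 where
  app n := ↾(fun σ => (d (n := n.unop) σ : StdSimplex ℝ (NZ2.obj n)))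
  naturality _ _ f := ConcreteCategory.hom_ext _ _ fun σ => h f.unop σ

theorem SDist.on_ofFamily {Z : SSet.{0}}
    (d : ∀ {n : SimplexCategory}, Z.obj (op n) → StdSimplex ℝ (Fin n.len → ZMod 2))
    (h : ∀ {m n : SimplexCategory} (f : m ⟶ n) (σ : Z.obj (op n)),
      d (Z.map f.op σ) = (d σ).map (nerveMap f)) {n : SimplexCategory} (σ : Z.obj (op n)) :
    (SDist.ofFamily d h).on σ = d σ :=
  rfl

/-- A map into the nerve of `ℤ/2` from a compatible family of outcomes. -/
def ofOutcomes {Z : SSet.{0}} (a : ∀ {n : SimplexCategory}, Z.obj (op n) → Fin n.len → ZMod 2)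
    (h : ∀ {m n : SimplexCategory} (f : m ⟶ n) (σ : Z.obj (op n)),
      a (Z.map f.op σ) = nerveMap f (a σ)) : Z ⟶ NZ2 where
  app n := ↾(fun σ => (a (n := n.unop) σ : NZ2.obj n))
  naturality _ _ f := ConcreteCategory.hom_ext _ _ fun σ => h f.unop σ

/-! ### Coboundaries -/

/-- The operator `[0] → [n]` picking the vertex `i`. -/
abbrev vertexOp (n : SimplexCategory) (i : Fin (n.len + 1)) : ⦋0⦌ ⟶ n :=
  SimplexCategory.const ⦋0⦌ n i

/-- The `i`-th vertex of a simplex. -/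
def vertexOf {Z : SSet.{0}} {n : SimplexCategory} (σ : Z.obj (op n)) (i : Fin (n.len + 1)) :
    Z _⦋0⦌ :=
  Z.map (vertexOp n i).op σ

theorem vertexOf_map {Z : SSet.{0}} {m n : SimplexCategory} (f : m ⟶ n) (σ : Z.obj (op n))
    (i : Fin (m.len + 1)) : vertexOf (Z.map f.op σ) i = vertexOf σ (f i) := by
  unfold vertexOf
  rw [← comp_apply, ← Functor.map_comp, ← op_comp]
  rfl

/-- The potential on the vertices of a simplex given by a function on the vertices of `Z`. -/
noncomputable def vertexPotential {Z : SSet.{0}} (w : Z _⦋0⦌ → ZMod 2) {n : SimplexCategory}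
    (σ : Z.obj (op n)) (t : ℕ) : ZMod 2 :=
  if h : t < n.len + 1 then w (vertexOf σ ⟨t, h⟩) else 0

theorem vertexPotential_val {Z : SSet.{0}} (w : Z _⦋0⦌ → ZMod 2) {n : SimplexCategory}
    (σ : Z.obj (op n)) (i : Fin (n.len + 1)) : vertexPotential w σ i.val = w (vertexOf σ i) :=
  dif_pos i.isLt

/-- The map into the nerve of `ℤ/2` given by the coboundary of a function on vertices. -/
noncomputable def coboundary {Z : SSet.{0}} (w : Z _⦋0⦌ → ZMod 2) : Z ⟶ NZ2 :=
  ofOutcomes (fun {n} σ => increments (vertexPotential w σ) n.len) fun f σ => by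
    symm
    refine nerveMap_increments _ _ _ 0 fun i => ?_
    rw [vertexPotential_val, vertexPotential_val, add_zero, vertexOf_map]

/-! ### Distributions on the cone with fair edges at the apex -/

/-- The potential on a simplex `(c_k, σ)` of the cone which vanishes on the copies of the apex and
is the one of `a`, shifted by `b`, on the other vertices. -/
def conePotential {l : ℕ} (k : ℕ) (a : Fin l → ZMod 2) (b : ZMod 2) (t : ℕ) : ZMod 2 :=
  if t ≤ k then 0 else b + partialSum a (t - (k + 1))

section conePotential

variable {m n : SimplexCategory} {f : m ⟶ n} {k l : ℕ} (a : Fin l → ZMod 2) (b : ZMod 2)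

/-- No copy of the apex survives, so the offset `b` is a global constant and disappears. -/
theorem nerveMap_conePotential_base {g : m ⟶ ⦋l⦌}
    (hg : ∀ i : Fin (m.len + 1), (f i).val = k + 1 + (g i).val) :
    nerveMap f (increments (conePotential k a b) n.len) = nerveMap g a := by
  refine (nerveMap_increments f _ (partialSum (nerveMap g a))
    (b + partialSum a (g 0).val) fun i => ?_).trans (increments_partialSum _)
  have h1 := partialSum_nerveMap g a i.val i.isLt
  rw [h1, conePotential, if_neg (by have := hg i; omega), hg i, Nat.add_sub_cancel_left]
  generalize partialSum a (g 0).val = u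
  generalize partialSum a (g ⟨i.val, i.isLt⟩).val = v
  -- What remains is v - u = (b + v) + (b + u), true in characteristic 2.
  revert u v b
  decide

theorem nerveMap_conePotential_apex (hf : ∀ i : Fin (m.len + 1), (f i).val ≤ k) :
    nerveMap f (increments (conePotential k a b) n.len) = increments (fun _ => 0) m.len := by
  refine nerveMap_increments _ _ _ 0 fun i => ?_
  rw [conePotential, if_pos (hf i)]
  simp

/-- The restricted potential starts at the vertex `g 0`, so its partial sum there moves into the
offset. -/
theorem nerveMap_conePotential_join {k' l' : ℕ} (h' : k' + 1 + l' = m.len) {g : ⦋l'⦌ ⟶ ⦋l⦌}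
    (hf : ∀ i : Fin (m.len + 1), i.val ≤ k' → (f i).val ≤ k)
    (hg : ∀ i : Fin (l' + 1), (f ⟨k' + 1 + i.val, by omega⟩).val = k + 1 + (g i).val) :
    nerveMap f (increments (conePotential k a b) n.len) =
      increments (conePotential k' (nerveMap g a : Fin l' → ZMod 2)
        (b + partialSum a (g 0).val)) m.len := by
  refine nerveMap_increments _ _ _ 0 fun i => ?_
  by_cases hi : i.val ≤ k'
  · rw [conePotential, if_pos hi, conePotential, if_pos (hf i hi), add_zero]
  · have hi' := i.isLt
    have h0 : i.val - (k' + 1) < l' + 1 := by omega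
    have h1 := hg ⟨i.val - (k' + 1), h0⟩
    have h2 : (⟨k' + 1 + (i.val - (k' + 1)), by omega⟩ : Fin (m.len + 1)) = i := by
      ext
      simp only
      omega
    simp only [h2] at h1
    have h3 : partialSum (nerveMap g a : Fin l' → ZMod 2) (i.val - (k' + 1)) = _ :=
      partialSum_nerveMap g a (i.val - (k' + 1)) h0
    rw [conePotential, if_neg hi, conePotential, if_neg (by omega), h1, Nat.add_sub_cancel_left, h3]
    generalize partialSum a (g 0).val = u
    generalize partialSum a (g ⟨i.val - (k' + 1), h0⟩).val = v
    revert u v b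
    decide

end conePotential

/-- The values of `fairExt φ`. -/
noncomputable def fairExtFun {X : SSet.{0}} (φ : X ⟶ NZ2) {n : SimplexCategory}
    (x : ConeSimplex X n) : StdSimplex ℝ (Fin n.len → ZMod 2) :=
  match x with
  | .apex => StdSimplex.single (increments (fun _ => 0) n.len)
  | .base σ => StdSimplex.single (outcome φ σ)
  | .join k _ _ σ => coin.map fun b => increments (conePotential k (outcome φ σ) b) n.len

/-- If no apex vertex or only apex vertices survive, the outcome no longer depends on the coin;
otherwise the coin is shifted by a constant, which does not change its law. -/
theorem fairExtFun_coneAct {X : SSet.{0}} (φ : X ⟶ NZ2) {m n : SimplexCategory} (f : m ⟶ n)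
    (x : ConeSimplex X n) :
    fairExtFun φ (coneAct X f x) = (fairExtFun φ x).map (nerveMap f) := by
  cases x with
  | apex =>
    simp only [fairExtFun, coneAct, StdSimplex.map_single]
    exact congrArg _ (nerveMap_increments _ _ _ 0 fun i => by simp).symm
  | base σ =>
    simp only [fairExtFun, coneAct, StdSimplex.map_single]
    exact congrArg _ (outcome_map φ f σ)
  | join k l h σ =>
    rcases cone_cases f k l h with ⟨g, hg⟩ | hg | ⟨k', l', h', g, ha, hb⟩
    · rw [coneAct_join_base X f k l h σ g hg]
      simp only [fairExtFun, StdSimplex.map_map]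
      rw [outcome_map, ← StdSimplex.map_const coin]
      congr 1
      funext b
      exact (nerveMap_conePotential_base _ b hg).symm
    · rw [coneAct_join_apex X f k l h σ hg]
      simp only [fairExtFun, StdSimplex.map_map]
      rw [← StdSimplex.map_const coin]
      congr 1
      funext b
      exact (nerveMap_conePotential_apex _ b hg).symm
    · rw [coneAct_join_join X f k l k' l' h h' σ g ha hb]
      simp only [fairExtFun, StdSimplex.map_map]
      rw [outcome_map, ← map_coin_add _ (partialSum (outcome φ σ) (g 0).val)]
      congr 1
      funext b
      exact (nerveMap_conePotential_join _ b h' ha hb).symm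

/-- The simplicial distribution on the cone which is deterministic on the base, given there by
`φ`, and uniform on the edges at the apex. -/
noncomputable def fairExt {X : SSet.{0}} (φ : X ⟶ NZ2) : SDist (cone X) NZ2 :=
  SDist.ofFamily (Z := cone X) (fun {n} (x : ConeSimplex X n) => fairExtFun φ x)
    (fairExtFun_coneAct φ)

/-! ### Simplices of one-dimensional simplicial sets and of their cones -/

theorem exists_edge_map_eq (X : SSet.{0}) [X.HasDimensionLE 1] {n : SimplexCategory}
    (σ : X.obj (op n)) : ∃ (g : n ⟶ ⦋1⦌) (y : X _⦋1⦌), σ = X.map g.op y := by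
  induction n using SimplexCategory.rec with
  | _ n =>
    obtain ⟨m, f, _, z, rfl⟩ := X.exists_nonDegenerate σ
    have hm := X.dim_le_of_nonDegenerate z 1
    obtain ⟨z, hz⟩ := z
    obtain rfl | rfl : m = 0 ∨ m = 1 := by omega
    -- A vertex is a face of its own degenerate edge, so vertices and edges are treated alike.
    · refine ⟨f ≫ SimplexCategory.δ 0, X.map (SimplexCategory.σ 0).op z, ?_⟩
      have h : SimplexCategory.δ (0 : Fin 2) ≫ SimplexCategory.σ (0 : Fin 1) = 𝟙 ⦋0⦌ :=
        SimplexCategory.δ_comp_σ_self (i := (0 : Fin 1))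
      rw [← comp_apply, ← Functor.map_comp, ← op_comp, Category.assoc, h, Category.comp_id]
    · exact ⟨f, z, rfl⟩

theorem exists_vertex_of_degenerate {X : SSet.{0}} {y : X _⦋1⦌} (hy : y ∉ X.nonDegenerate 1) :
    ∃ v : X _⦋0⦌, y = X.σ 0 v := by
  rw [← SSet.mem_degenerate_iff_notMem_nonDegenerate, SSet.degenerate_eq_iUnion_range_σ] at hy
  obtain ⟨i, v, rfl⟩ := Set.mem_iUnion.1 hy
  exact ⟨v, by rw [Fin.fin_one_eq_zero i]⟩

/-- The operator `[n] → [2]` sending the first `k + 1` vertices to `0` and being `1 + g` on the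
other ones. -/
def joinOp {n : SimplexCategory} {k l : ℕ} (h : k + 1 + l = n.len) (g : ⦋l⦌ ⟶ ⦋1⦌) : n ⟶ ⦋2⦌ :=
  SimplexCategory.Hom.mk
    { toFun := fun i => if hi : i.val ≤ k then (0 : Fin 3) else
        (g ⟨i.val - (k + 1), by have := i.isLt; simp only; omega⟩).succ
      monotone' := fun a b hab => by
        have hab' : a.val ≤ b.val := hab
        by_cases ha : a.val ≤ k
        · simp only [ha, dite_true]
          exact Fin.zero_le _
        · have hb : ¬ b.val ≤ k := by omega
          simp only [ha, hb, dite_false]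
          refine Fin.succ_le_succ_iff.2 (g.toOrderHom.monotone ?_)
          simp only [Fin.mk_le_mk]
          omega }

/-- The triangles, including those on degenerate edges, generate the cone. The apex is listed
separately because `X` may be empty. -/
theorem coneSimplex_cases (X : SSet.{0}) [X.HasDimensionLE 1] {n : SimplexCategory}
    (x : ConeSimplex X n) :
    x = .apex ∨ ∃ (f : n ⟶ ⦋2⦌) (y : X _⦋1⦌), x = (cone X).map f.op (coneTriangle y) := by
  cases x with
  | apex => exact Or.inl rfl
  | base σ =>
    obtain ⟨g, y, rfl⟩ := exists_edge_map_eq X σ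
    refine Or.inr ⟨g ≫ SimplexCategory.δ 0, y, Eq.symm ?_⟩
    refine coneAct_join_base X _ 0 1 rfl y g fun i => ?_
    change ((SimplexCategory.δ (0 : Fin 3)) (g i)).val = _
    generalize g i = j
    revert j
    decide
  | join k l h σ =>
    obtain ⟨g, y, rfl⟩ := exists_edge_map_eq X σ
    refine Or.inr ⟨joinOp h g, y, Eq.symm ?_⟩
    refine coneAct_join_join X _ 0 1 k l rfl h y g (fun i hi => ?_) (fun i => ?_)
    · change (dite _ _ _ : Fin 3).val ≤ 0
      rw [dif_pos hi]
      rfl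
    · change (dite _ _ _ : Fin 3).val = _
      rw [dif_neg (by simp only; omega)]
      simp [add_comm]

/-- The edge of the cone from the apex to a vertex. -/
def coneSpoke {X : SSet.{0}} (v : X _⦋0⦌) : (cone X) _⦋1⦌ :=
  ConeSimplex.join 0 0 rfl v

/-- The inclusion of a simplicial set into its cone. -/
def coneBase (X : SSet.{0}) : X ⟶ cone X where
  app n := ↾(fun σ => (ConeSimplex.base (n := n.unop) σ : (cone X).obj n))

theorem coneTriangle_face_zero {X : SSet.{0}} (y : X _⦋1⦌) :
    (cone X).map (SimplexCategory.δ (0 : Fin 3)).op (coneTriangle y) =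
      (coneBase X).app (op ⦋1⦌) y := by
  refine (coneAct_join_base X (SimplexCategory.δ (0 : Fin 3)) 0 1 rfl y (𝟙 _) fun i => ?_).trans ?_
  · revert i; decide
  · simp
    rfl

theorem coneTriangle_face_one {X : SSet.{0}} (y : X _⦋1⦌) :
    (cone X).map (SimplexCategory.δ (1 : Fin 3)).op (coneTriangle y) = coneSpoke (X.δ 0 y) :=
  coneAct_join_join X (SimplexCategory.δ (1 : Fin 3)) 0 1 0 0 rfl rfl y (SimplexCategory.δ 0)
    (by decide) (by decide)

theorem coneTriangle_face_two {X : SSet.{0}} (y : X _⦋1⦌) :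
    (cone X).map (SimplexCategory.δ (2 : Fin 3)).op (coneTriangle y) = coneSpoke (X.δ 1 y) :=
  coneAct_join_join X (SimplexCategory.δ (2 : Fin 3)) 0 1 0 0 rfl rfl y (SimplexCategory.δ 1)
    (by decide) (by decide)

theorem coneSpoke_degeneracy {X : SSet.{0}} (v : X _⦋0⦌) :
    (cone X).map (SimplexCategory.σ (1 : Fin 2)).op (coneSpoke v) = coneTriangle (X.σ 0 v) :=
  coneAct_join_join X (SimplexCategory.σ (1 : Fin 2)) 0 0 0 1 rfl rfl v (SimplexCategory.σ 0)
    (by decide) (by decide)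

/-! ### Generalities on finite distributions -/

theorem weights_map_eq_sum {A B : Type*} [Fintype A] [DecidableEq B] (p : StdSimplex ℝ A)
    (f : A → B) (b : B) : (p.map f).weights b = ∑ a, if f a = b then p.weights a else 0 := by
  rw [StdSimplex.weights_map, Finsupp.mapDomain, Finsupp.sum_fintype _ _ (by simp),
    Finsupp.finsetSum_apply]
  exact Finset.sum_congr rfl fun a _ => by rw [Finsupp.single_apply]

theorem map_injective {A B : Type*} {f : A → B} (hf : Function.Injective f)
    {p q : StdSimplex ℝ A} (h : p.map f = q.map f) : p = q := by
  ext1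
  exact Finsupp.mapDomain_injective hf (congrArg StdSimplex.weights h)

theorem iConvexComb_single_comp {A B : Type*} (p : StdSimplex ℝ A) (f : A → B) :
    iConvexComb p (fun a => (StdSimplex.single (f a) : StdSimplex ℝ B)) = p.map f := by
  rw [← iConvexComb_map p f StdSimplex.single]
  ext1
  rw [StdSimplex.weights_iConvexComb]
  simp

theorem sum_zmod_two (f : ZMod 2 → ℝ) : ∑ a, f a = f 0 + f 1 :=
  Fin.sum_univ_two f

theorem sum_weights {A : Type*} [Fintype A] (p : StdSimplex ℝ A) : ∑ a, p.weights a = 1 := by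
  rw [← p.total, Finsupp.sum_fintype _ _ (by simp)]

theorem coin_weights (a : ZMod 2) : coin.weights a = 1 / 2 := by
  rcases zmod_two_cases a with rfl | rfl <;> simp [coin]

/-! ### Values on the triangles and edges of the cone -/

/-- The entries of a `2`-simplex of the nerve. -/
def entries (s : Fin (SimplexCategory.mk 2).len → ZMod 2) : ZMod 2 × ZMod 2 :=
  (s (0 : Fin 2), s (1 : Fin 2))

theorem entries_injective : Function.Injective entries := by
  intro s t h
  rw [entries, entries, Prod.mk.injEq] at h
  funext i
  change Fin 2 at i
  fin_cases i
  · exact h.1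
  · exact h.2

/-- The entry of a `1`-simplex of the nerve. -/
def entry (s : Fin (SimplexCategory.mk 1).len → ZMod 2) : ZMod 2 :=
  s (0 : Fin 1)

theorem entry_face_zero : ∀ s : Fin (SimplexCategory.mk 2).len → ZMod 2,
    entry (nerveMap (SimplexCategory.δ (0 : Fin 3)) s) = (entries s).2 := by
  change ∀ s : Fin 2 → ZMod 2, _
  decide

theorem entry_face_one : ∀ s : Fin (SimplexCategory.mk 2).len → ZMod 2,
    entry (nerveMap (SimplexCategory.δ (1 : Fin 3)) s) = (entries s).1 + (entries s).2 := by
  change ∀ s : Fin 2 → ZMod 2, _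
  decide

theorem entry_face_two : ∀ s : Fin (SimplexCategory.mk 2).len → ZMod 2,
    entry (nerveMap (SimplexCategory.δ (2 : Fin 3)) s) = (entries s).1 := by
  change ∀ s : Fin 2 → ZMod 2, _
  decide

theorem entries_degeneracy : ∀ s : Fin (SimplexCategory.mk 1).len → ZMod 2,
    entries (nerveMap (SimplexCategory.σ (1 : Fin 2)) s) = (entry s, 0) := by
  change ∀ s : Fin 1 → ZMod 2, _
  decide

theorem entry_degeneracy (s : Fin (SimplexCategory.mk 0).len → ZMod 2) :
    entry (nerveMap (SimplexCategory.σ (0 : Fin 1)) s) = 0 := by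
  revert s
  change ∀ s : Fin 0 → ZMod 2, _
  decide

variable {X : SSet.{0}}

/-- The outcome assigned to an edge. -/
def edgeOutcome {Z : SSet.{0}} (φ : Z ⟶ NZ2) (y : Z _⦋1⦌) : ZMod 2 :=
  entry (outcome φ y)

theorem edgeOutcome_degenerate {Z : SSet.{0}} (φ : Z ⟶ NZ2) (v : Z _⦋0⦌) :
    edgeOutcome φ (Z.σ 0 v) = 0 := by
  rw [edgeOutcome, ← entry_degeneracy (outcome φ v)]
  exact congrArg entry (outcome_map φ (SimplexCategory.σ 0) v)

/-- The outcomes assigned to a triangle of the cone. -/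
def triangleOutcome (s : cone X ⟶ NZ2) (y : X _⦋1⦌) : ZMod 2 × ZMod 2 :=
  entries (outcome s (coneTriangle y))

/-- The outcome assigned to an edge at the apex. -/
def spokeOutcome (s : cone X ⟶ NZ2) (v : X _⦋0⦌) : ZMod 2 :=
  entry (outcome s (coneSpoke v))

theorem spokeOutcome_source (s : cone X ⟶ NZ2) (y : X _⦋1⦌) :
    spokeOutcome s (X.δ 1 y) = (triangleOutcome s y).1 := by
  rw [spokeOutcome, ← coneTriangle_face_two, outcome_map, entry_face_two]
  rfl

theorem spokeOutcome_target (s : cone X ⟶ NZ2) (y : X _⦋1⦌) :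
    spokeOutcome s (X.δ 0 y) = (triangleOutcome s y).1 + (triangleOutcome s y).2 := by
  rw [spokeOutcome, ← coneTriangle_face_one, outcome_map, entry_face_one]
  rfl

theorem edgeOutcome_coneBase (s : cone X ⟶ NZ2) (y : X _⦋1⦌) :
    edgeOutcome (coneBase X ≫ s) y = (triangleOutcome s y).2 := by
  rw [triangleOutcome, ← entry_face_zero, ← outcome_map, coneTriangle_face_zero]
  rfl

/-- The distribution on a triangle of the cone. -/
noncomputable def SDist.tri (p : SDist (cone X) NZ2) (y : X _⦋1⦌) :
    StdSimplex ℝ (ZMod 2 × ZMod 2) :=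
  (p.on (coneTriangle y)).map entries

/-- The distribution on an edge at the apex. -/
noncomputable def SDist.spoke (p : SDist (cone X) NZ2) (v : X _⦋0⦌) : StdSimplex ℝ (ZMod 2) :=
  (p.on (coneSpoke v)).map entry

theorem SDist.spoke_source (p : SDist (cone X) NZ2) (y : X _⦋1⦌) :
    p.spoke (X.δ 1 y) = (p.tri y).map Prod.fst := by
  rw [SDist.spoke, ← coneTriangle_face_two, SDist.on_map, SDist.tri, StdSimplex.map_map,
    StdSimplex.map_map]
  simp only [entry_face_two]

theorem SDist.spoke_target (p : SDist (cone X) NZ2) (y : X _⦋1⦌) :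
    p.spoke (X.δ 0 y) = (p.tri y).map (fun a => a.1 + a.2) := by
  rw [SDist.spoke, ← coneTriangle_face_one, SDist.on_map, SDist.tri, StdSimplex.map_map,
    StdSimplex.map_map]
  simp only [entry_face_one]

/-- The triangle on a degenerate edge is a degenerate apex edge, so data on triangles includes the
data at vertices. -/
theorem SDist.tri_degenerate (p : SDist (cone X) NZ2) (v : X _⦋0⦌) :
    p.tri (X.σ 0 v) = (p.spoke v).map (fun a => (a, 0)) := by
  rw [SDist.tri, ← coneSpoke_degeneracy, SDist.on_map, SDist.spoke, StdSimplex.map_map,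
    StdSimplex.map_map]
  simp only [entries_degeneracy]

theorem SDist.spoke_source_weights (p : SDist (cone X) NZ2) (y : X _⦋1⦌) (a : ZMod 2) :
    (p.spoke (X.δ 1 y)).weights a = (p.tri y).weights (a, 0) + (p.tri y).weights (a, 1) := by
  rw [SDist.spoke_source, weights_map_eq_sum, Fintype.sum_prod_type, Finset.sum_eq_single a]
  · simp only [if_true, sum_zmod_two]
  · intro b _ hb
    simp [hb]
  · simp

theorem SDist.spoke_target_weights (p : SDist (cone X) NZ2) (y : X _⦋1⦌) (a : ZMod 2) :
    (p.spoke (X.δ 0 y)).weights a = (p.tri y).weights (a, 0) + (p.tri y).weights (a + 1, 1) := by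
  rw [SDist.spoke_target, weights_map_eq_sum, Fintype.sum_prod_type_right]
  have h : ∀ b c : ZMod 2, c + b = a ↔ c = a - b := fun b c => eq_sub_iff_add_eq.symm
  simp only [h, Finset.sum_ite_eq', Finset.mem_univ, if_true]
  have h1 : a + 1 = a - 1 := by revert a; decide
  rw [h1, sum_zmod_two, sub_zero]

theorem SDist.tri_degenerate_weights (p : SDist (cone X) NZ2) (v : X _⦋0⦌) (a b : ZMod 2) :
    (p.tri (X.σ 0 v)).weights (a, b) = if b = 0 then (p.spoke v).weights a else 0 := by
  rw [SDist.tri_degenerate, weights_map_eq_sum]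
  simp only [Prod.mk.injEq]
  by_cases hb : b = 0
  · simp [hb]
  · simp [hb, Ne.symm hb]

/-! ### Reduction to the triangles of the cone -/

theorem SDist.on_apex (p : SDist (cone X) NZ2) (n : SimplexCategory) :
    p.on (Z := cone X) (n := n) ConeSimplex.apex = StdSimplex.single (nerveMap
      (SimplexCategory.const n ⦋0⦌ 0) (0 : Fin 0 → ZMod 2)) := by
  have h : (ConeSimplex.apex : ConeSimplex X n) = (cone X).map (SimplexCategory.const n ⦋0⦌ 0).op
    (ConeSimplex.apex : ConeSimplex X ⦋0⦌) := rfl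
  rw [h]
  refine (SDist.on_map p _ _).trans ?_
  -- The nerve has only one 0-simplex, hence there is only one distribution on it.
  have h0 : ∀ d : StdSimplex ℝ (Fin (SimplexCategory.mk 0).len → ZMod 2),
      d = StdSimplex.single (R := ℝ) (0 : Fin (SimplexCategory.mk 0).len → ZMod 2) := by
    intro d
    have : Unique (Fin (SimplexCategory.mk 0).len → ZMod 2) :=
      inferInstanceAs (Unique (Fin 0 → ZMod 2))
    refine (StdSimplex.map_id d).symm.trans ?_
    rw [← StdSimplex.map_const d]
    exact congrArg (fun f => d.map f) (funext fun x => Subsingleton.elim _ _)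
  exact (congrArg _ (h0 _)).trans (StdSimplex.map_single _ _)

/-- A simplicial distribution on the cone of a one-dimensional simplicial set is determined by its
values on the triangles. -/
theorem SDist.ext_tri [X.HasDimensionLE 1] {p q : SDist (cone X) NZ2}
    (h : ∀ y : X _⦋1⦌, p.tri y = q.tri y) : p = q := by
  refine SDist.ext_on fun n x => ?_
  rcases coneSimplex_cases X x with rfl | ⟨f, y, rfl⟩
  · rw [SDist.on_apex, SDist.on_apex]
  · rw [SDist.on_map, SDist.on_map]
    exact congrArg _ (map_injective entries_injective (h y))

theorem mul_weights_map_le {A B : Type*} [Fintype A] {p q : StdSimplex ℝ A} {c : ℝ}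
    (h : ∀ a, c * p.weights a ≤ q.weights a) (f : A → B) (b : B) :
    c * (p.map f).weights b ≤ (q.map f).weights b := by
  classical
  rw [weights_map_eq_sum, weights_map_eq_sum, Finset.mul_sum]
  refine Finset.sum_le_sum fun a _ => ?_
  split_ifs
  · exact h a
  · simp

theorem SDist.tri_weights (p : SDist (cone X) NZ2) (y : X _⦋1⦌)
    (s : Fin (SimplexCategory.mk 2).len → ZMod 2) :
    (p.tri y).weights (entries s) = (p.on (coneTriangle y)).weights s := by
  rw [SDist.tri, StdSimplex.weights_map, Finsupp.mapDomain_apply entries_injective]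

/-- Push-forward preserves domination, so it suffices to test it on the generating triangles. The
bound `c ≤ 1` serves the apex, where both sides are the same point mass. -/
theorem SDist.mul_weights_le_of_tri [X.HasDimensionLE 1] {p q : SDist (cone X) NZ2} {c : ℝ}
    (hc : c ≤ 1) (h : ∀ (y : X _⦋1⦌) (a : ZMod 2 × ZMod 2),
      c * (p.tri y).weights a ≤ (q.tri y).weights a) {n : SimplexCategory}
    (x : (cone X).obj (op n)) (a : Fin n.len → ZMod 2) :
    c * (p.on x).weights a ≤ (q.on x).weights a := by
  rcases coneSimplex_cases X x with rfl | ⟨f, y, rfl⟩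
  · rw [SDist.on_apex, SDist.on_apex]
    exact mul_le_of_le_one_left (StdSimplex.weights_nonneg _) hc
  · rw [SDist.on_map, SDist.on_map]
    refine mul_weights_map_le (fun s => ?_) _ _
    rw [← SDist.tri_weights, ← SDist.tri_weights]
    exact h y _

/-! ### Triangles of particular distributions -/

/-- The distribution on a triangle of the cone which is uniform on the edges at the apex and
deterministic on the opposite edge. -/
noncomputable def fairTri (b : ZMod 2) : StdSimplex ℝ (ZMod 2 × ZMod 2) :=
  coin.map fun a => (a, b)

theorem fairTri_weights (b : ZMod 2) (c : ZMod 2 × ZMod 2) :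
    (fairTri b).weights c = if c.2 = b then 1 / 2 else 0 := by
  obtain ⟨a, c⟩ := c
  rw [fairTri, weights_map_eq_sum]
  simp only [Prod.mk.injEq, coin_weights]
  by_cases h : c = b
  · simp [h]
  · simp [h, Ne.symm h]

theorem fairTri_injective : Function.Injective fairTri := by
  intro b c h
  by_contra hbc
  have := congrArg (fun d => d.weights ((0 : ZMod 2), b)) h
  simp [fairTri_weights, hbc] at this

theorem tri_fairExt (φ : X ⟶ NZ2) (y : X _⦋1⦌) : (fairExt φ).tri y = fairTri (edgeOutcome φ y) := by
  have h : (fairExt φ).on (coneTriangle y) = coin.map fun b =>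
    (increments (conePotential 0 (outcome φ y : Fin 1 → ZMod 2) b) 2 : Fin 2 → ZMod 2) := rfl
  rw [SDist.tri, h]
  refine (StdSimplex.map_map _ _ _).trans ?_
  rw [fairTri]
  congr 1
  funext b
  rw [edgeOutcome]
  generalize (outcome φ y) = a
  revert b a
  change ∀ (b : ZMod 2) (a : Fin 1 → ZMod 2), _
  decide

theorem tri_mul (p q : SDist (cone X) NZ2) (y : X _⦋1⦌) :
    (p.mul q).tri y = conv (p.tri y) (q.tri y) :=
  conv_map entries (fun _ _ => rfl) (p.on (coneTriangle y)) (q.on (coneTriangle y))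

theorem tri_det (s : cone X ⟶ NZ2) (y : X _⦋1⦌) :
    (SDist.det s).tri y = StdSimplex.single (triangleOutcome s y) :=
  StdSimplex.map_single _ _

theorem tri_theta (d : StdSimplex ℝ (cone X ⟶ NZ2)) (y : X _⦋1⦌) :
    (Theta d).tri y = d.map fun s => triangleOutcome s y :=
  StdSimplex.map_map d (fun s => outcome s (coneTriangle y)) entries

/-- The uniform first coordinate absorbs any independent summand; only the deterministic second
coordinates add up. -/
theorem conv_fairTri (b c : ZMod 2) : conv (fairTri b) (fairTri c) = fairTri (b + c) := by
  rw [conv, fairTri, iConvexComb_map, fairTri, fairTri]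
  simp only [StdSimplex.map_map, Prod.mk_add_mk]
  refine Eq.trans ?_ (iConvexComb_const coin _)
  congr 1
  funext a
  simp only [add_comm a]
  exact map_coin_add (fun x => (x, b + c)) a

theorem conv_single_fairTri (a : ZMod 2 × ZMod 2) (c : ZMod 2) :
    conv (StdSimplex.single a) (fairTri c) = fairTri (a.2 + c) := by
  rw [conv, iConvexComb_single, fairTri, StdSimplex.map_map, fairTri,
    ← map_coin_add (fun b => (b, a.2 + c)) a.1]
  congr 1
  funext b
  rw [add_comm b]
  rfl

theorem conv_fairTri_single (c : ZMod 2) (a : ZMod 2 × ZMod 2) :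
    conv (fairTri c) (StdSimplex.single a) = fairTri (c + a.2) := by
  rw [conv, fairTri, iConvexComb_map]
  simp only [StdSimplex.map_single]
  rw [iConvexComb_single_comp, fairTri,
    ← map_coin_add (fun b => (b, c + a.2)) a.1]
  rfl

theorem at_eq_pPlus_iff (p : SDist (cone X) NZ2) (y : X _⦋1⦌) :
    p.at (coneTriangle y) = pPlus ↔ p.tri y = fairTri 0 := by
  have h : (pPlus.map entries : StdSimplex ℝ (ZMod 2 × ZMod 2)) = fairTri 0 := by
    rw [fairTri, map_coin]
    exact StdSimplex.map_duple _ _ _ _ _ _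
  rw [← h]
  exact ⟨fun h => congrArg (StdSimplex.map entries) h, fun h => map_injective entries_injective h⟩

theorem at_eq_pMinus_iff (p : SDist (cone X) NZ2) (y : X _⦋1⦌) :
    p.at (coneTriangle y) = pMinus ↔ p.tri y = fairTri 1 := by
  have h : (pMinus.map entries : StdSimplex ℝ (ZMod 2 × ZMod 2)) = fairTri 1 := by
    rw [fairTri, map_coin]
    exact StdSimplex.map_duple _ _ _ _ _ _
  rw [← h]
  exact ⟨fun h => congrArg (StdSimplex.map entries) h, fun h => map_injective entries_injective h⟩

theorem mem_GPM_iff (p : SDist (cone X) NZ2) :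
    p ∈ GPM X ↔ ∀ τ ∈ X.nonDegenerate 1, ∃ b, p.tri τ = fairTri b := by
  refine forall₂_congr fun τ _ => ?_
  rw [at_eq_pPlus_iff, at_eq_pMinus_iff]
  constructor
  · rintro (h | h)
    exacts [⟨0, h⟩, ⟨1, h⟩]
  · rintro ⟨b, h⟩
    rcases zmod_two_cases b with rfl | rfl
    exacts [Or.inl h, Or.inr h]

/-! ### Maps into the nerve from functions on edges -/

theorem nerveMap_comp {p m n : SimplexCategory} (g : p ⟶ m) (f : m ⟶ n)
    (a : Fin n.len → ZMod 2) : nerveMap (g ≫ f) a = nerveMap g (nerveMap f a) :=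
  ConcreteCategory.congr_hom (NZ2.map_comp f.op g.op) a

theorem nerveMap_id {n : SimplexCategory} (a : Fin n.len → ZMod 2) : nerveMap (𝟙 n) a = a :=
  ConcreteCategory.congr_hom (NZ2.map_id (op n)) a

/-- The operator `[1] → [n]` picking the edge from `i` to `i + 1`. -/
def stepOp (n : SimplexCategory) (i : Fin n.len) : ⦋1⦌ ⟶ n :=
  SimplexCategory.Hom.mk
    { toFun := fun j => ⟨i.val + j.val, by
        have := i.isLt
        have : j.val < 1 + 1 := j.isLt
        omega⟩
      monotone' := fun _ _ h => Fin.mk_le_mk.2 (Nat.add_le_add_left h _) }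

theorem entry_nerveMap_stepOp {n : SimplexCategory} (i : Fin n.len) (a : Fin n.len → ZMod 2) :
    entry (nerveMap (stepOp n i) a) = a i := by
  rw [entry, nerveMap_apply]
  change partialSum a (i.val + 1) - partialSum a i.val = a i
  rw [partialSum_succ a i.isLt]
  simp

/-- A monotone self-map of a two-element chain is either the identity or constant. -/
theorem eq_id_or_factors_of_edge_end (h : ⦋1⦌ ⟶ ⦋1⦌) :
    h = 𝟙 _ ∨ ∃ g : ⦋0⦌ ⟶ ⦋1⦌, h = SimplexCategory.σ (0 : Fin 1) ≫ g := by
  have hm : h (0 : Fin 2) ≤ h (1 : Fin 2) := h.toOrderHom.monotone (by decide)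
  by_cases h01 : h (0 : Fin 2) = h (1 : Fin 2)
  · refine Or.inr ⟨SimplexCategory.const _ _ (h (0 : Fin 2)), ?_⟩
    ext i : 3
    change Fin 2 at i
    fin_cases i
    · rfl
    · exact h01.symm
  · refine Or.inl ?_
    have key : ∀ a b : Fin 2, a ≤ b → a ≠ b → a = 0 ∧ b = 1 := by decide
    obtain ⟨h0, h1⟩ := key _ _ hm h01
    ext i : 3
    change Fin 2 at i
    fin_cases i
    · exact h0
    · exact h1

section ofEdges

variable {X : SSet.{0}} (φ : X _⦋1⦌ → ZMod 2) (hφ : ∀ v, φ (X.σ 0 v) = 0)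

include hφ in
theorem edge_end_apply (h : ⦋1⦌ ⟶ ⦋1⦌) (y : X _⦋1⦌) :
    φ (X.map h.op y) = entry (nerveMap h fun _ => φ y) := by
  rcases eq_id_or_factors_of_edge_end h with rfl | ⟨g, rfl⟩
  · rw [nerveMap_id, entry, op_id, CategoryTheory.Functor.map_id, id_apply]
  · rw [op_comp, Functor.map_comp, comp_apply, nerveMap_comp, entry_degeneracy]
    exact hφ _

/-- The successive edges of a simplex, evaluated by a function on edges. -/
def stepOutcome {n : SimplexCategory} (σ : X.obj (op n)) : Fin n.len → ZMod 2 :=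
  fun i => φ (X.map (stepOp n i).op σ)

-- Every simplex comes from a single edge along some `g`, so at most one of its steps is that edge
-- and the others are degenerate. This is why a function on edges needs no cocycle condition.
include hφ in
theorem stepOutcome_map {n : SimplexCategory} (g : n ⟶ ⦋1⦌) (y : X _⦋1⦌) :
    stepOutcome φ (X.map g.op y) = nerveMap g fun _ => φ y := by
  funext i
  rw [stepOutcome, ← comp_apply, ← Functor.map_comp, ← op_comp, edge_end_apply φ hφ,
    nerveMap_comp, entry_nerveMap_stepOp]

/-- The map from a one-dimensional simplicial set to the nerve of `ℤ/2` given by a function on the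
edges that vanishes on the degenerate ones. -/
def ofEdges [X.HasDimensionLE 1] : X ⟶ NZ2 :=
  ofOutcomes (fun σ => stepOutcome φ σ) fun {m n} f σ => by
    obtain ⟨g, y, rfl⟩ := exists_edge_map_eq X σ
    rw [stepOutcome_map φ hφ, ← nerveMap_comp, ← stepOutcome_map φ hφ, op_comp, Functor.map_comp,
      comp_apply]

theorem edgeOutcome_ofEdges [X.HasDimensionLE 1] (y : X _⦋1⦌) :
    edgeOutcome (ofEdges φ hφ) y = φ y := by
  have h := stepOutcome_map φ hφ (𝟙 _) y
  rw [op_id, CategoryTheory.Functor.map_id, id_apply, nerveMap_id] at h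
  exact congrArg entry h

end ofEdges

/-! ### Sections over the cone -/

section coneSection

variable {X : SSet.{0}}

/-- The extension by zero to the vertices of the cone of a function on vertices. -/
def coneVertexFun (w : X _⦋0⦌ → ZMod 2) (x : (cone X) _⦋0⦌) : ZMod 2 :=
  match (x : ConeSimplex X ⦋0⦌) with
  | .base v => w v
  | _ => 0

/-- The map from the cone to the nerve of `ℤ/2` with prescribed values on the edges at the
apex. -/
noncomputable def coneSection (w : X _⦋0⦌ → ZMod 2) : cone X ⟶ NZ2 :=
  coboundary (Z := cone X) (coneVertexFun w)

theorem spokeOutcome_coneSection (w : X _⦋0⦌ → ZMod 2) (v : X _⦋0⦌) :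
    spokeOutcome (coneSection w) v = w v := by
  have h0 : vertexOf (Z := cone X) (coneSpoke v) (0 : Fin 2) = ConeSimplex.apex :=
    coneAct_join_apex X (vertexOp ⦋1⦌ (0 : Fin 2)) 0 0 rfl v fun _ => le_rfl
  have h1 : vertexOf (Z := cone X) (coneSpoke v) (1 : Fin 2) = ConeSimplex.base v := by
    refine (coneAct_join_base X (vertexOp ⦋1⦌ (1 : Fin 2)) 0 0 rfl v (𝟙 _) fun i => ?_).trans ?_
    · revert i; decide
    · simp
  refine (congrArg₂ (· - ·) ?_ ?_).trans (sub_zero (w v))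
  · exact (vertexPotential_val (coneVertexFun w) (coneSpoke v) (1 : Fin 2)).trans
      (congrArg (coneVertexFun w) h1)
  · exact (vertexPotential_val (coneVertexFun w) (coneSpoke v) (0 : Fin 2)).trans
      (congrArg (coneVertexFun w) h0)

theorem triangleOutcome_coneSection (w : X _⦋0⦌ → ZMod 2) (y : X _⦋1⦌) :
    triangleOutcome (coneSection w) y = (w (X.δ 1 y), w (X.δ 0 y) - w (X.δ 1 y)) := by
  have h1 := spokeOutcome_source (coneSection w) y
  have h0 := spokeOutcome_target (coneSection w) y
  rw [spokeOutcome_coneSection] at h0 h1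
  refine Prod.ext h1.symm ?_
  rw [h0, h1, add_sub_cancel_left]

/-- A function on edges is a coboundary. -/
def IsCoboundary (φ : X _⦋1⦌ → ZMod 2) : Prop :=
  ∃ w : X _⦋0⦌ → ZMod 2, ∀ y, φ y = w (X.δ 0 y) - w (X.δ 1 y)

theorem triangleOutcome_snd (s : cone X ⟶ NZ2) (y : X _⦋1⦌) :
    (triangleOutcome s y).2 = spokeOutcome s (X.δ 0 y) - spokeOutcome s (X.δ 1 y) := by
  rw [spokeOutcome_source, spokeOutcome_target, add_sub_cancel_left]

/-- Each base edge closes a triangle with two apex edges, so the values on the apex edges form a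
potential. -/
theorem isCoboundary_coneBase (s : cone X ⟶ NZ2) :
    IsCoboundary (edgeOutcome (coneBase X ≫ s)) :=
  ⟨spokeOutcome s, fun y => by rw [edgeOutcome_coneBase, triangleOutcome_snd]⟩

theorem edgeOutcome_coneBase_coneSection (w : X _⦋0⦌ → ZMod 2) (y : X _⦋1⦌) :
    edgeOutcome (coneBase X ≫ coneSection w) y = w (X.δ 0 y) - w (X.δ 1 y) := by
  rw [edgeOutcome_coneBase, triangleOutcome_coneSection]

end coneSection

/-! ### The distributions `fairExt φ` -/

section fairExt

variable {X : SSet.{0}} [X.HasDimensionLE 1]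

theorem SDist.eq_fairExt {p : SDist (cone X) NZ2} {φ : X ⟶ NZ2}
    (h : ∀ y, p.tri y = fairTri (edgeOutcome φ y)) : p = fairExt φ :=
  SDist.ext_tri fun y => (h y).trans (tri_fairExt φ y).symm

theorem fairExt_eq_iff {φ ψ : X ⟶ NZ2} :
    fairExt φ = fairExt ψ ↔ ∀ y, edgeOutcome φ y = edgeOutcome ψ y := by
  constructor
  · intro h y
    refine fairTri_injective ?_
    rw [← tri_fairExt, ← tri_fairExt, h]
  · intro h
    exact SDist.eq_fairExt fun y => by rw [tri_fairExt, h]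

theorem mul_det_eq_fairExt {φ ψ : X ⟶ NZ2} {s : cone X ⟶ NZ2}
    (h : ∀ y, edgeOutcome ψ y = edgeOutcome φ y + edgeOutcome (coneBase X ≫ s) y) :
    (fairExt φ).mul (SDist.det s) = fairExt ψ :=
  SDist.eq_fairExt fun y => by
    rw [tri_mul, tri_det, tri_fairExt, conv_fairTri_single, h, edgeOutcome_coneBase]

theorem det_mul_eq_fairExt {φ ψ : X ⟶ NZ2} {s : cone X ⟶ NZ2}
    (h : ∀ y, edgeOutcome ψ y = edgeOutcome (coneBase X ≫ s) y + edgeOutcome φ y) :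
    (SDist.det s).mul (fairExt φ) = fairExt ψ :=
  SDist.eq_fairExt fun y => by
    rw [tri_mul, tri_det, tri_fairExt, conv_single_fairTri, h, edgeOutcome_coneBase]

theorem fairExt_mul_eq {φ ψ χ : X ⟶ NZ2}
    (h : ∀ y, edgeOutcome χ y = edgeOutcome φ y + edgeOutcome ψ y) :
    (fairExt φ).mul (fairExt ψ) = fairExt χ :=
  SDist.eq_fairExt fun y => by
    rw [tri_mul, tri_fairExt, tri_fairExt, conv_fairTri, h]

/-- Multiplying by a deterministic distribution adds its restriction to the base, and these
restrictions are exactly the coboundaries. -/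
theorem fairExt_mem_detOrbit_iff {φ ψ : X ⟶ NZ2} (hψ : ∀ y, edgeOutcome ψ y = 0) :
    fairExt φ ∈ detOrbit (fairExt ψ) ↔ IsCoboundary (edgeOutcome φ) := by
  constructor
  · rintro ⟨s, hs⟩
    rw [mul_det_eq_fairExt (ψ := coneBase X ≫ s) fun y => by rw [hψ, zero_add],
      fairExt_eq_iff] at hs
    rw [funext hs]
    exact isCoboundary_coneBase s
  · rintro ⟨w, hw⟩
    refine ⟨coneSection w, (mul_det_eq_fairExt fun y => ?_).symm⟩
    rw [hψ, zero_add, edgeOutcome_coneBase_coneSection, hw]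

/-- Non-negative weights cannot cancel, so the support maps into the support of the image. -/
theorem eq_of_map_eq_single {A B : Type*} {d : StdSimplex ℝ A} {f : A → B} {b : B}
    (h : d.map f = StdSimplex.single b) {a : A} (ha : d.weights a ≠ 0) : f a = b := by
  by_contra hb
  have h1 : (d.map f).weights (f a) = 0 := by
    rw [h, StdSimplex.weights_single]
    exact Finsupp.single_eq_of_ne hb
  rw [StdSimplex.weights_map, Finsupp.mapDomain, Finsupp.sum_apply, Finsupp.sum,
    Finset.sum_eq_zero_iff_of_nonneg] at h1
  · have := h1 a (Finsupp.mem_support_iff.2 ha)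
    rw [Finsupp.single_eq_same] at this
    exact ha this
  · intro x _
    exact (Finsupp.single_nonneg.2 (StdSimplex.weights_nonneg x)) _

theorem map_snd_fairTri (b : ZMod 2) : (fairTri b).map Prod.snd = StdSimplex.single b := by
  rw [fairTri, StdSimplex.map_map, StdSimplex.map_const]

-- The base edges are deterministic, so a single assignment from the support of a decomposition
-- already restricts to `φ`; it extends over the cone, hence its restriction is a coboundary.
omit [X.HasDimensionLE 1] in
theorem isCoboundary_of_nonContextual {φ : X ⟶ NZ2} (h : (fairExt φ).NonContextual) :
    IsCoboundary (edgeOutcome φ) := by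
  obtain ⟨d, hd⟩ := h
  obtain ⟨s, hs⟩ := d.support_weights_nonempty
  have key : edgeOutcome φ = edgeOutcome (coneBase X ≫ s) := by
    funext y
    have h1 : d.map (fun s => (triangleOutcome s y).2) = StdSimplex.single (edgeOutcome φ y) := by
      rw [← map_snd_fairTri, ← tri_fairExt, ← hd, tri_theta, StdSimplex.map_map]
    rw [edgeOutcome_coneBase]
    exact (eq_of_map_eq_single h1 (Finsupp.mem_support_iff.1 hs)).symm
  rw [key]
  exact isCoboundary_coneBase s

theorem nonContextual_fairExt_iff {φ : X ⟶ NZ2} :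
    (fairExt φ).NonContextual ↔ IsCoboundary (edgeOutcome φ) := by
  refine ⟨isCoboundary_of_nonContextual, fun ⟨w, hw⟩ => ?_⟩
  -- The two potentials `w` and `w + 1` have the same coboundary; mixing them equally makes every
  -- apex edge fair.
  refine ⟨coin.map fun b => coneSection fun v => w v + b, SDist.eq_fairExt fun y => ?_⟩
  rw [tri_theta, StdSimplex.map_map, fairTri, hw, ← map_coin_add (fun b => (b, _)) (w (X.δ 1 y))]
  congr 1
  funext b
  rw [triangleOutcome_coneSection, add_sub_add_right_eq_sub, add_comm]

/-- If every vertex is an end point of a non-degenerate edge, then the non-degenerate triangles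
determine the simplicial distributions on the cone. -/
theorem SDist.ext_nonDegenerate
    (hX : ∀ v : X _⦋0⦌, ∃ τ ∈ X.nonDegenerate 1, X.δ 0 τ = v ∨ X.δ 1 τ = v)
    {p q : SDist (cone X) NZ2} (h : ∀ τ ∈ X.nonDegenerate 1, p.tri τ = q.tri τ) : p = q := by
  refine SDist.ext_tri fun y => ?_
  by_cases hy : y ∈ X.nonDegenerate 1
  · exact h y hy
  · obtain ⟨v, rfl⟩ := exists_vertex_of_degenerate hy
    rw [SDist.tri_degenerate, SDist.tri_degenerate]
    -- The apex edge at `v` is a face of a non-degenerate triangle, so its distribution is a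
    -- marginal.
    obtain ⟨τ, hτ, rfl | rfl⟩ := hX v
    · rw [SDist.spoke_target, SDist.spoke_target, h τ hτ]
    · rw [SDist.spoke_source, SDist.spoke_source, h τ hτ]

open Classical in
/-- The map into the nerve given by a function on the non-degenerate edges. -/
noncomputable def ofNonDegenerate (φ : X.nonDegenerate 1 → ZMod 2) : X ⟶ NZ2 :=
  ofEdges (fun y => if h : y ∈ X.nonDegenerate 1 then φ ⟨y, h⟩ else 0) fun v =>
    dif_neg fun h => h (X.σ_mem_degenerate 0 v)

theorem edgeOutcome_ofNonDegenerate (φ : X.nonDegenerate 1 → ZMod 2) (τ : X.nonDegenerate 1) :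
    edgeOutcome (ofNonDegenerate φ) τ.1 = φ τ := by
  rw [ofNonDegenerate, edgeOutcome_ofEdges, dif_pos τ.2]

omit [X.HasDimensionLE 1] in
theorem edgeOutcome_of_degenerate (φ : X ⟶ NZ2) {y : X _⦋1⦌} (hy : y ∉ X.nonDegenerate 1) :
    edgeOutcome φ y = 0 := by
  obtain ⟨v, rfl⟩ := exists_vertex_of_degenerate hy
  exact edgeOutcome_degenerate φ v

omit [X.HasDimensionLE 1] in
theorem edgeOutcome_eq_of_nonDegenerate {φ ψ : X ⟶ NZ2}
    (h : ∀ τ : X.nonDegenerate 1, edgeOutcome φ τ.1 = edgeOutcome ψ τ.1) (y : X _⦋1⦌) :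
    edgeOutcome φ y = edgeOutcome ψ y := by
  by_cases hy : y ∈ X.nonDegenerate 1
  · exact h ⟨y, hy⟩
  · rw [edgeOutcome_of_degenerate φ hy, edgeOutcome_of_degenerate ψ hy]

omit [X.HasDimensionLE 1] in
theorem fairExt_mem_GPM (φ : X ⟶ NZ2) : fairExt φ ∈ GPM X :=
  (mem_GPM_iff _).2 fun τ _ => ⟨_, tri_fairExt φ τ⟩

end fairExt

/-! ### Extreme points -/

theorem SDist.prob_injective {Z : SSet.{0}} :
    Function.Injective (SDist.prob (X := Z) (Y := NZ2)) := by
  intro p q h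
  refine SDist.ext_on fun n σ => ?_
  induction n using SimplexCategory.rec with
  | _ n =>
    ext a
    exact congrFun h ⟨n, σ, a⟩

/-- The complement of a multiple of a distribution inside another one, rescaled. -/
noncomputable def remainder {A : Type*} [Fintype A] (q r : StdSimplex ℝ A) {c : ℝ} (hc : c < 1)
    (h : ∀ a, c * r.weights a ≤ q.weights a) : StdSimplex ℝ A where
  weights := Finsupp.equivFunOnFinite.symm fun a => (1 - c)⁻¹ * (q.weights a - c * r.weights a)
  nonneg a := mul_nonneg (inv_nonneg.2 (by linarith)) (sub_nonneg.2 (h a))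
  total := by
    rw [Finsupp.sum_fintype _ _ (by simp)]
    simp only [Finsupp.equivFunOnFinite_symm_apply_apply]
    rw [← Finset.mul_sum, Finset.sum_sub_distrib, ← Finset.mul_sum, sum_weights, sum_weights,
      mul_one]
    exact inv_mul_cancel₀ (by linarith)

theorem remainder_weights {A : Type*} [Fintype A] (q r : StdSimplex ℝ A) {c : ℝ} (hc : c < 1)
    (h : ∀ a, c * r.weights a ≤ q.weights a) (a : A) :
    (remainder q r hc h).weights a = (1 - c)⁻¹ * (q.weights a - c * r.weights a) :=
  rfl

theorem remainder_map {A B : Type*} [Fintype A] [Fintype B] (q r : StdSimplex ℝ A) {c : ℝ}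
    (hc : c < 1) (h : ∀ a, c * r.weights a ≤ q.weights a) (f : A → B) :
    (remainder q r hc h).map f =
      remainder (q.map f) (r.map f) hc (mul_weights_map_le h f) := by
  classical
  ext b
  rw [remainder_weights, weights_map_eq_sum, weights_map_eq_sum, weights_map_eq_sum,
    Finset.mul_sum, ← Finset.sum_sub_distrib, Finset.mul_sum]
  refine Finset.sum_congr rfl fun a _ => ?_
  rw [remainder_weights]
  split_ifs <;> simp

theorem remainder_congr {A : Type*} [Fintype A] {q r q' r' : StdSimplex ℝ A} {c : ℝ}
    (hc : c < 1) (h : ∀ a, c * r.weights a ≤ q.weights a)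
    (h' : ∀ a, c * r'.weights a ≤ q'.weights a) (hq : q = q') (hr : r = r') :
    remainder q r hc h = remainder q' r' hc h' := by
  subst hq hr
  rfl

/-- An extreme point does not dominate a positive multiple of another distribution. -/
theorem SDist.IsVertex.eq_of_mul_weights_le {Z : SSet.{0}} {q r : SDist Z NZ2} (hq : q.IsVertex)
    {c : ℝ} (hc : 0 < c) (h : ∀ {n : SimplexCategory} (σ : Z.obj (op n)) (a : Fin n.len → ZMod 2),
      c * (r.on σ).weights a ≤ (q.on σ).weights a) : q = r := by
  -- A smaller factor gives a weaker inequality, so a factor of at least 1 may be replaced by 1/2.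
  wlog hc1 : c < 1 generalizing c
  · refine this (c := 1 / 2) (by norm_num) (fun σ a => le_trans ?_ (h σ a)) (by norm_num)
    exact mul_le_mul_of_nonneg_right (by linarith) (StdSimplex.weights_nonneg _)
  -- Write q = c r + (1 - c) q'; the rescaled difference commutes with push-forward, so it is again
  -- simplicial.
  let q' : SDist Z NZ2 := SDist.ofFamily (fun σ => remainder (q.on σ) (r.on σ) hc1 (h σ))
    fun f σ => by
      rw [remainder_map]
      exact remainder_congr hc1 _ _ (SDist.on_map q f σ) (SDist.on_map r f σ)
  have key : ∀ {n : SimplexCategory} (σ : Z.obj (op n)) (a : Fin n.len → ZMod 2),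
      c * (r.on σ).weights a + (1 - c) * (q'.on σ).weights a = (q.on σ).weights a := by
    intro n σ a
    rw [SDist.on_ofFamily, remainder_weights, mul_inv_cancel_left₀ (by linarith)]
    ring
  have hmem := (mem_extremePoints.1 hq).2 r.prob ⟨r, rfl⟩ q'.prob ⟨q', rfl⟩
    ⟨c, 1 - c, hc, by linarith, by ring, ?_⟩
  · exact (SDist.prob_injective hmem.1).symm
  · funext ⟨n, σ, a⟩
    exact key σ a

theorem nonContextual_det {Z : SSet.{0}} (s : Z ⟶ NZ2) : (SDist.det s).NonContextual :=
  ⟨StdSimplex.single s, SDist.ext_on fun _ _ => StdSimplex.map_single _ _⟩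

/-! ### Extremality over the cone -/

section vertices

variable {X : SSet.{0}} [X.HasDimensionLE 1]

/-- Domination forces the second outcome on each triangle, and only the bias on the apex edges is
left free. A nonzero bias would have a sign that trivializes `φ`. Connectedness enters as `hconn`, a
form that also holds trivially on a one-vertex quotient. -/
theorem eq_fairExt_of_mul_weights_le
    (hconn : ∀ g : X _⦋0⦌ → ℝ, (∀ y, g (X.δ 0 y) = g (X.δ 1 y)) → ∀ v v', g v = g v')
    {φ : X ⟶ NZ2} (hφ : ¬ IsCoboundary (edgeOutcome φ)) {q : SDist (cone X) NZ2} {c : ℝ}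
    (hc : 0 < c) (h : ∀ y a, c * (q.tri y).weights a ≤ ((fairExt φ).tri y).weights a) :
    q = fairExt φ := by
  have hzero : ∀ y a b, b ≠ edgeOutcome φ y → (q.tri y).weights (a, b) = 0 := by
    intro y a b hb
    have h1 := h y (a, b)
    rw [tri_fairExt, fairTri_weights, if_neg hb] at h1
    exact le_antisymm (nonpos_of_mul_nonpos_right h1 hc) (StdSimplex.weights_nonneg _)
  have hone : ∀ y, (q.tri y).weights (0, edgeOutcome φ y) +
      (q.tri y).weights (1, edgeOutcome φ y) = 1 := by
    intro y
    have h1 := sum_weights (q.tri y)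
    rw [Fintype.sum_prod_type, sum_zmod_two, Finset.sum_eq_single (edgeOutcome φ y),
      Finset.sum_eq_single (edgeOutcome φ y)] at h1
    · exact h1
    · exact fun b _ hb => hzero y 1 b hb
    · simp
    · exact fun b _ hb => hzero y 0 b hb
    · simp
  have hsource : ∀ y, (q.spoke (X.δ 1 y)).weights 0 = (q.tri y).weights (0, edgeOutcome φ y) := by
    intro y
    rw [SDist.spoke_source_weights]
    rcases zmod_two_cases (edgeOutcome φ y) with h0 | h0
    · rw [h0, hzero y 0 1 (by rw [h0]; decide), add_zero]
    · rw [h0, hzero y 0 0 (by rw [h0]; decide), zero_add]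
  have htarget : ∀ y, (q.spoke (X.δ 0 y)).weights 0 =
      (q.tri y).weights (edgeOutcome φ y, edgeOutcome φ y) := by
    intro y
    rw [SDist.spoke_target_weights]
    rcases zmod_two_cases (edgeOutcome φ y) with h0 | h0
    · rw [h0, hzero y _ 1 (by rw [h0]; decide), add_zero]
    · rw [h0, hzero y 0 0 (by rw [h0]; decide), zero_add, zero_add]
  -- The bias of the apex edges: outcome 1 on an edge swaps the two apex outcomes and so flips its
  -- sign.
  let g : X _⦋0⦌ → ℝ := fun v => (q.spoke v).weights 0 - 1 / 2
  have hg : ∀ y, (edgeOutcome φ y = 0 ∧ g (X.δ 0 y) = g (X.δ 1 y)) ∨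
      (edgeOutcome φ y = 1 ∧ g (X.δ 0 y) = - g (X.δ 1 y)) := by
    intro y
    have h1 := hone y
    simp only [g, hsource, htarget]
    rcases zmod_two_cases (edgeOutcome φ y) with h0 | h0
    · exact Or.inl ⟨h0, by rw [h0]⟩
    · refine Or.inr ⟨h0, ?_⟩
      rw [h0] at h1 ⊢
      linarith
  have habs : ∀ v v', |g v| = |g v'| := by
    refine hconn _ fun y => ?_
    rcases hg y with ⟨_, h1⟩ | ⟨_, h1⟩
    · rw [h1]
    · rw [h1, abs_neg]
  by_cases hall : ∀ v, g v = 0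
  · refine SDist.eq_fairExt fun y => ?_
    have h1 : (q.tri y).weights (0, edgeOutcome φ y) = 1 / 2 := by
      rw [← hsource]
      exact sub_eq_zero.1 (hall _)
    have h2 := hone y
    ext ⟨a, b⟩
    rw [fairTri_weights]
    by_cases hb : b = edgeOutcome φ y
    · rw [if_pos hb, hb]
      rcases zmod_two_cases a with rfl | rfl <;> linarith
    · rw [if_neg hb, hzero y a b hb]
  · push Not at hall
    obtain ⟨v₀, hv₀⟩ := hall
    have hne : ∀ v, g v ≠ 0 := fun v hv => hv₀ (by
      rw [← abs_eq_zero, habs v₀ v, hv, abs_zero])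
    -- The sign of the bias is a potential for `φ`, since it changes exactly along the edges with
    -- value 1.
    refine absurd ⟨fun v => if 0 < g v then 0 else 1, fun y => ?_⟩ hφ
    have h1 := hne (X.δ 1 y)
    rcases hg y with ⟨h0, h2⟩ | ⟨h0, h2⟩
    · simp only [h0, h2, sub_self]
    · simp only [h0, h2]
      rcases lt_or_gt_of_ne h1 with h3 | h3
      · rw [if_pos (by linarith), if_neg (by linarith)]
        decide
      · rw [if_neg (by linarith), if_pos h3]
        decide

omit [X.HasDimensionLE 1] in
theorem tri_weights_of_prob_eq {p q r : SDist (cone X) NZ2} {s t : ℝ}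
    (h : s • q.prob + t • r.prob = p.prob) (y : X _⦋1⦌) (a : ZMod 2 × ZMod 2) :
    s * (q.tri y).weights a + t * (r.tri y).weights a = (p.tri y).weights a := by
  have h1 := congrFun h ⟨2, coneTriangle y, (![a.1, a.2] : Fin 2 → ZMod 2)⟩
  have h2 : a = entries ![a.1, a.2] := rfl
  rw [h2, SDist.tri_weights, SDist.tri_weights, SDist.tri_weights]
  exact h1

/-- Each term of a convex decomposition, scaled by its positive coefficient, is dominated by the
sum. -/
theorem isVertex_fairExt
    (hconn : ∀ g : X _⦋0⦌ → ℝ, (∀ y, g (X.δ 0 y) = g (X.δ 1 y)) → ∀ v v', g v = g v')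
    {φ : X ⟶ NZ2} (hφ : ¬ IsCoboundary (edgeOutcome φ)) : (fairExt φ).IsVertex := by
  refine mem_extremePoints.2 ⟨⟨_, rfl⟩, ?_⟩
  rintro _ ⟨q, rfl⟩ _ ⟨r, rfl⟩ ⟨s, t, hs, ht, _, h⟩
  have key := tri_weights_of_prob_eq h
  refine ⟨congrArg _ (eq_fairExt_of_mul_weights_le hconn hφ hs fun y a => ?_),
    congrArg _ (eq_fairExt_of_mul_weights_le hconn hφ ht fun y a => ?_)⟩
  · rw [← key y a]
    exact le_add_of_nonneg_right (mul_nonneg ht.le (StdSimplex.weights_nonneg _))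
  · rw [← key y a]
    exact le_add_of_nonneg_left (mul_nonneg hs.le (StdSimplex.weights_nonneg _))

theorem eq_of_mul_single_le {q : SDist (cone X) NZ2} (hq : q.IsVertex) {s : cone X ⟶ NZ2} {c : ℝ}
    (hc : 0 < c) (hc1 : c ≤ 1) (h : ∀ y, c ≤ (q.tri y).weights (triangleOutcome s y)) :
    q = SDist.det s := by
  refine hq.eq_of_mul_weights_le hc (SDist.mul_weights_le_of_tri hc1 fun y a => ?_)
  rw [tri_det, StdSimplex.weights_single]
  by_cases ha : a = triangleOutcome s y
  · rw [ha, Finsupp.single_eq_same, mul_one]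
    exact h y
  · rw [Finsupp.single_eq_of_ne ha, mul_zero]
    exact StdSimplex.weights_nonneg _

/-- Contextual extreme points on the cone of a bouquet of circles. -/
theorem exists_eq_fairExt_of_isVertex [Subsingleton (X _⦋0⦌)] (v₀ : X _⦋0⦌)
    {q : SDist (cone X) NZ2} (hq : q.IsVertex) (hctx : q.Contextual) :
    ∃ ψ : X ⟶ NZ2, q = fairExt ψ := by
  have hu : (q.spoke v₀).weights 0 + (q.spoke v₀).weights 1 = 1 :=
    (sum_zmod_two _).symm.trans (sum_weights _)
  have hn : ∀ y a b, 0 ≤ (q.tri y).weights (a, b) := fun y a b => StdSimplex.weights_nonneg _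
  have hu0 : 0 ≤ (q.spoke v₀).weights 0 := StdSimplex.weights_nonneg _
  have hu1 : 0 ≤ (q.spoke v₀).weights 1 := StdSimplex.weights_nonneg _
  have e0 : ∀ y, (q.tri y).weights (0, 0) + (q.tri y).weights (0, 1) = (q.spoke v₀).weights 0 :=
    fun y => by rw [Subsingleton.elim v₀ (X.δ 1 y), SDist.spoke_source_weights]
  have e1 : ∀ y, (q.tri y).weights (1, 0) + (q.tri y).weights (1, 1) = (q.spoke v₀).weights 1 :=
    fun y => by rw [Subsingleton.elim v₀ (X.δ 1 y), SDist.spoke_source_weights]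
  have e2 : ∀ y, (q.tri y).weights (1, 0) + (q.tri y).weights (0, 1) = (q.spoke v₀).weights 1 :=
    fun y => by
      rw [Subsingleton.elim v₀ (X.δ 0 y), SDist.spoke_target_weights]
      rfl
  -- Write u₀, u₁ for the common apex weights. Each triangle has the form t₀₁ = t₁₁ = t, t₁₀ = u₁ -
  -- t, t₀₀ = u₀ - t. If u₁ < 1/2, then t ≤ u₁ gives t₀₀ ≥ 1 - 2u₁ > 0, and the zero assignment is
  -- dominated. The case u₁ > 1/2 is symmetric, with constant potential 1.
  rcases lt_trichotomy ((q.spoke v₀).weights 1) (1 / 2) with hlt | heq | hgt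
  · refine absurd ?_ hctx
    rw [eq_of_mul_single_le hq (s := coneSection fun _ => 0) (c := 1 - 2 * (q.spoke v₀).weights 1)
      (by linarith) (by linarith) fun y => ?_]
    · exact nonContextual_det _
    · rw [triangleOutcome_coneSection, sub_self]
      linarith [e0 y, e1 y, e2 y, hn y 1 0]
  · classical
    -- With u₀ = u₁ = 1/2, each triangle is a mixture of the two fair ones with weights 1 - 2t and
    -- 2t. Taking the heavier one (threshold t = 1/4) ensures a weight of at least 1/2; degenerate
    -- edges have t = 0 and get value 0.
    let ψ : X ⟶ NZ2 := ofEdges (fun y => if (q.tri y).weights (0, 1) ≤ 1 / 4 then 0 else 1)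
      fun v => if_pos (by
        rw [SDist.tri_degenerate_weights, if_neg (by decide)]
        norm_num)
    refine ⟨ψ, hq.eq_of_mul_weights_le (c := 1 / 2) (by norm_num)
      (SDist.mul_weights_le_of_tri (by norm_num) ?_)⟩
    rintro y ⟨a, b⟩
    rw [tri_fairExt, fairTri_weights, edgeOutcome_ofEdges]
    have h0 := e0 y
    have h1 := e1 y
    have h2 := e2 y
    have h3 := hn y a b
    simp only
    by_cases ht : (q.tri y).weights (0, 1) ≤ 1 / 4
    · rw [if_pos ht]
      by_cases hb : b = 0
      · subst hb
        rw [if_pos rfl]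
        rcases zmod_two_cases a with rfl | rfl <;> linarith
      · rw [if_neg hb]
        linarith
    · rw [if_neg ht]
      by_cases hb : b = 1
      · subst hb
        rw [if_pos rfl]
        rcases zmod_two_cases a with rfl | rfl <;> linarith
      · rw [if_neg hb]
        linarith
  · refine absurd ?_ hctx
    rw [eq_of_mul_single_le hq (s := coneSection fun _ => 1) (c := 2 * (q.spoke v₀).weights 1 - 1)
      (by linarith) (by linarith) fun y => ?_]
    · exact nonContextual_det _
    · rw [triangleOutcome_coneSection, sub_self]
      linarith [e0 y, e1 y, e2 y, hn y 0 0]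

end vertices

/-! ### Connectedness -/

/-- A function that agrees at the ends of every edge descends to `π₀`, which is a single point. -/
theorem eq_of_isConnected {X : SSet.{0}} [X.IsConnected] {A : Type*} (g : X _⦋0⦌ → A)
    (hg : ∀ y : X _⦋1⦌, g (X.δ 0 y) = g (X.δ 1 y)) (v v' : X _⦋0⦌) : g v = g v' := by
  let G : SSet.π₀ X → A := SSet.π₀.lift g fun x₀ x₁ e => by
    have h := hg e.edge
    rw [e.src_eq, e.tgt_eq] at h
    exact h.symm
  exact congrArg G (Subsingleton.elim (SSet.π₀.mk v) (SSet.π₀.mk v'))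

/-! ### Potentials on trees -/

/-- The potential at a vertex is the sum of the labels along the unique path from a root. -/
theorem exists_potential_of_isTree {V : Type*} {G : SimpleGraph V} (hG : G.IsTree)
    (label : Sym2 V → ZMod 2) :
    ∃ w : V → ZMod 2, ∀ a b, G.Adj a b → label s(a, b) = w b - w a := by
  obtain ⟨r⟩ := hG.connected.nonempty
  choose p hp _ using hG.existsUnique_path r
  have key : ∀ a b (h : G.Adj a b), a ∈ (p b).support →
      label s(a, b) = ((p b).edges.map label).sum - ((p a).edges.map label).sum := by
    intro a b h ha
    rw [hG.isAcyclic.path_concat (hp a) (hp b) h ha, SimpleGraph.Walk.edges_concat,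
      List.concat_eq_append, List.map_append, List.sum_append]
    simp
  refine ⟨fun v => ((p v).edges.map label).sum, fun a b h => ?_⟩
  -- In a tree, one end of each edge lies on the root path of the other end; the orientation is
  -- irrelevant mod 2.
  by_cases ha : a ∈ (p b).support
  · exact key a b h ha
  · have hb := hG.isAcyclic.mem_support_of_ne_mem_support_of_adj_of_isPath (hp a) (hp b) h ha
    rw [Sym2.eq_swap, key b a h.symm hb]
    have hsub : ∀ x y : ZMod 2, y - x = x - y := by decide
    exact hsub _ _

theorem underlyingGraph_adj {Z : SSet.{0}} {v w : Z _⦋0⦌} : (underlyingGraph Z).Adj v w ↔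
    v ≠ w ∧ ∃ τ : Z _⦋1⦌, s(Z.δ 1 τ, Z.δ 0 τ) = s(v, w) := by
  rw [underlyingGraph, SimpleGraph.fromRel_adj, and_congr_right_iff]
  intro _
  simp only [Sym2.eq_iff, exists_or]

theorem delta_one_sigma {Z : SSet.{0}} (v : Z _⦋0⦌) : Z.δ 1 (Z.σ 0 v) = v :=
  Z.δ_comp_σ_succ_apply (i := (0 : Fin 1)) v

theorem delta_zero_sigma {Z : SSet.{0}} (v : Z _⦋0⦌) : Z.δ 0 (Z.σ 0 v) = v :=
  Z.δ_comp_σ_self_apply (i := (0 : Fin 1)) v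

theorem isCoboundary_of_isTree {Z : SSet.{0}} (hZ : IsTree Z) {φ : Z _⦋1⦌ → ZMod 2}
    (hφ : ∀ v, φ (Z.σ 0 v) = 0) : IsCoboundary φ := by
  classical
  obtain ⟨_, hloop, hpar, hG⟩ := hZ
  -- Without parallel edges, the value of `φ` depends only on the unordered pair of end points.
  let label : Sym2 (Z _⦋0⦌) → ZMod 2 := fun e =>
    if h : ∃ τ ∈ Z.nonDegenerate 1, s(Z.δ 1 τ, Z.δ 0 τ) = e then φ h.choose else 0
  have hlabel : ∀ τ ∈ Z.nonDegenerate 1, label s(Z.δ 1 τ, Z.δ 0 τ) = φ τ := by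
    intro τ hτ
    have h : ∃ τ' ∈ Z.nonDegenerate 1, s(Z.δ 1 τ', Z.δ 0 τ') = s(Z.δ 1 τ, Z.δ 0 τ) :=
      ⟨τ, hτ, rfl⟩
    simp only [label]
    rw [dif_pos h]
    exact congrArg φ (hpar _ h.choose_spec.1 _ hτ h.choose_spec.2)
  obtain ⟨w, hw⟩ := exists_potential_of_isTree hG label
  refine ⟨w, fun y => ?_⟩
  by_cases hy : y ∈ Z.nonDegenerate 1
  · rw [← hlabel y hy]
    exact hw _ _ (underlyingGraph_adj.2 ⟨hloop y hy, y, rfl⟩)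
  · obtain ⟨v, rfl⟩ := exists_vertex_of_degenerate hy
    rw [hφ, delta_one_sigma, delta_zero_sigma, sub_self]

theorem eq_of_isTree {Z : SSet.{0}} (hZ : IsTree Z) {A : Type*} {w : Z _⦋0⦌ → A}
    (hw : ∀ y : Z _⦋1⦌, w (Z.δ 0 y) = w (Z.δ 1 y)) (v v' : Z _⦋0⦌) : w v = w v' := by
  obtain ⟨p⟩ := hZ.2.2.2.connected.preconnected v v'
  induction p with
  | nil => rfl
  | cons h p ih =>
    refine Eq.trans ?_ ih
    obtain ⟨_, τ, hτ⟩ := underlyingGraph_adj.1 h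
    rcases Sym2.eq_iff.1 hτ with ⟨h1, h2⟩ | ⟨h1, h2⟩
    · rw [← h1, ← h2, hw]
    · rw [← h1, ← h2, hw]

section subcomplex

variable {X : SSet.{0}} {T : X.Subcomplex}

theorem exists_coboundary_on_tree (hT : IsMaximalTree T) {φ : X _⦋1⦌ → ZMod 2}
    (hφ : ∀ v, φ (X.σ 0 v) = 0) : ∃ w : X _⦋0⦌ → ZMod 2,
      ∀ y ∈ T.obj (op ⦋1⦌), φ y = w (X.δ 0 y) - w (X.δ 1 y) := by
  obtain ⟨w, hw⟩ := isCoboundary_of_isTree hT.1 (φ := fun y => φ y.1) fun v => hφ v.1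
  exact ⟨fun v => w ⟨v, hT.2 v⟩, fun y hy => hw ⟨y, hy⟩⟩

theorem eq_of_isMaximalTree (hT : IsMaximalTree T) {A : Type*} {w : X _⦋0⦌ → A}
    (hw : ∀ y ∈ T.obj (op ⦋1⦌), w (X.δ 0 y) = w (X.δ 1 y)) (v v' : X _⦋0⦌) : w v = w v' :=
  eq_of_isTree hT.1 (w := fun u => w u.1) (fun y => hw y.1 y.2) ⟨v, hT.2 v⟩ ⟨v', hT.2 v'⟩

/-! ### Collapsing a maximal tree -/

theorem collapseMap_surjective (T : X.Subcomplex) (n : SimplexCategoryᵒᵖ) :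
    Function.Surjective ((collapseMap T).app n) :=
  Quot.mk_surjective

instance [X.HasDimensionLE 1] : (collapse T).HasDimensionLE 1 := by
  have : Epi (collapseMap T) := by
    have : ∀ n, Epi ((collapseMap T).app n) := fun n =>
      (epi_iff_surjective _).2 (collapseMap_surjective T n)
    exact NatTrans.epi_of_epi_app _
  exact SSet.hasDimensionLT_of_epi (collapseMap T) _

theorem subsingleton_collapse_vertices (hT : IsMaximalTree T) :
    Subsingleton ((collapse T) _⦋0⦌) :=
  ⟨fun a b => by
    obtain ⟨v, rfl⟩ := collapseMap_surjective T _ a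
    obtain ⟨v', rfl⟩ := collapseMap_surjective T _ b
    exact Quot.sound ⟨hT.2 v, hT.2 v'⟩⟩

/-- An edge of `T` is identified with the degenerate edge at its source, which also lies in `T`. -/
theorem collapseMap_degenerate {y : X _⦋1⦌} (hy : y ∈ T.obj (op ⦋1⦌)) :
    (collapseMap T).app (op ⦋1⦌) y =
      (collapse T).σ 0 ((collapseMap T).app (op ⦋0⦌) (X.δ 1 y)) :=
  Quot.sound ⟨hy, T.map (SimplexCategory.σ (0 : Fin 1)).op
    (T.map (SimplexCategory.δ (1 : Fin 2)).op hy)⟩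

theorem edgeOutcome_collapse (ψ : collapse T ⟶ NZ2) {y : X _⦋1⦌} (hy : y ∈ T.obj (op ⦋1⦌)) :
    edgeOutcome (collapseMap T ≫ ψ) y = 0 := by
  refine Eq.trans ?_ (edgeOutcome_degenerate ψ ((collapseMap T).app (op ⦋0⦌) (X.δ 1 y)))
  exact congrArg (edgeOutcome ψ) (collapseMap_degenerate hy)

theorem exists_collapse_factorization [X.HasDimensionLE 1] {φ : X _⦋1⦌ → ZMod 2}
    (hφ : ∀ v, φ (X.σ 0 v) = 0) (hT : ∀ y ∈ T.obj (op ⦋1⦌), φ y = 0) :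
    ∃ ψ : collapse T ⟶ NZ2, ∀ y, edgeOutcome (collapseMap T ≫ ψ) y = φ y := by
  let ψ : (collapse T) _⦋1⦌ → ZMod 2 :=
    Quot.lift φ fun a b h => (hT a h.1).trans (hT b h.2).symm
  have hψ : ∀ v, ψ ((collapse T).σ 0 v) = 0 := by
    intro v
    obtain ⟨v, rfl⟩ := collapseMap_surjective T _ v
    exact hφ v
  exact ⟨ofEdges ψ hψ, fun y => edgeOutcome_ofEdges ψ hψ ((collapseMap T).app _ y)⟩

theorem pullback_fairExt [X.HasDimensionLE 1] {X' : SSet.{0}} (f : X ⟶ X') (ψ : X' ⟶ NZ2) :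
    SDist.pullback (coneMap f) (fairExt ψ) = fairExt (f ≫ ψ) :=
  SDist.eq_fairExt fun y => tri_fairExt ψ (f.app _ y)

/-- A potential for the pull-back is constant along `T`, hence on all vertices, so the cochain
vanishes; surjectivity of the collapse transfers this to `ψ`. -/
theorem not_isCoboundary_collapse (hT : IsMaximalTree T) {ψ : collapse T ⟶ NZ2}
    (hψ : ¬ IsCoboundary (edgeOutcome ψ)) :
    ¬ IsCoboundary (edgeOutcome (collapseMap T ≫ ψ)) := by
  rintro ⟨w, hw⟩
  have hconst := eq_of_isMaximalTree hT (w := w) fun y hy => by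
    have h := hw y
    rw [edgeOutcome_collapse ψ hy] at h
    exact (sub_eq_zero.1 h.symm)
  refine hψ ⟨fun _ => 0, fun y => ?_⟩
  obtain ⟨y, rfl⟩ := collapseMap_surjective T _ y
  refine (hw y).trans ?_
  rw [hconst (X.δ 0 y) (X.δ 1 y), sub_self, sub_self]

theorem isCoboundary_congr_add {φ χ : X _⦋1⦌ → ZMod 2} (hχ : IsCoboundary χ) :
    IsCoboundary (fun y => χ y + φ y) ↔ IsCoboundary φ := by
  obtain ⟨w, hw⟩ := hχ
  constructor
  · rintro ⟨u, hu⟩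
    refine ⟨fun v => u v - w v, fun y => ?_⟩
    have h : χ y + φ y = _ := hu y
    rw [← add_sub_cancel_left (χ y) (φ y), h, hw]
    ring
  · rintro ⟨u, hu⟩
    refine ⟨fun v => w v + u v, fun y => ?_⟩
    simp only [hu, hw]
    ring

/-! ### Detected vertices as cochains that are not coboundaries -/

variable [X.HasDimensionLE 1]

/-- The sum of two maps into the nerve of `ℤ/2`. -/
def addNerve (φ ψ : X ⟶ NZ2) : X ⟶ NZ2 :=
  ofEdges (fun y => edgeOutcome φ y + edgeOutcome ψ y) fun v => by
    rw [edgeOutcome_degenerate, edgeOutcome_degenerate, add_zero]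

theorem edgeOutcome_addNerve (φ ψ : X ⟶ NZ2) (y : X _⦋1⦌) :
    edgeOutcome (addNerve φ ψ) y = edgeOutcome φ y + edgeOutcome ψ y :=
  edgeOutcome_ofEdges _ _ _

/-- Deterministic factors change the cochain by a coboundary and can be used to make it vanish on
`T`; pull-back along the collapse preserves whether a cochain is a coboundary. -/
theorem mem_detectedVertices_iff (v₀ : X _⦋0⦌) (hT : IsMaximalTree T)
    (p : SDist (cone X) NZ2) :
    p ∈ detectedVertices T ↔
      ∃ φ : X ⟶ NZ2, ¬ IsCoboundary (edgeOutcome φ) ∧ p = fairExt φ := by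
  have := subsingleton_collapse_vertices hT
  constructor
  · rintro ⟨s, q, hq, hctx, rfl⟩
    obtain ⟨ψ, rfl⟩ := exists_eq_fairExt_of_isVertex ((collapseMap T).app _ v₀) hq hctx
    have hψ : ¬ IsCoboundary (edgeOutcome ψ) := fun h => hctx (nonContextual_fairExt_iff.2 h)
    refine ⟨addNerve (coneBase X ≫ s) (collapseMap T ≫ ψ), ?_, ?_⟩
    · rw [funext (edgeOutcome_addNerve _ _), isCoboundary_congr_add (isCoboundary_coneBase s)]
      exact not_isCoboundary_collapse hT hψ
    · rw [pullback_fairExt]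
      exact det_mul_eq_fairExt (edgeOutcome_addNerve _ _)
  · rintro ⟨φ, hφ, rfl⟩
    obtain ⟨w, hw⟩ := exists_coboundary_on_tree hT (edgeOutcome_degenerate φ)
    have hs : ∀ y, edgeOutcome (coneBase X ≫ coneSection w) y = w (X.δ 0 y) - w (X.δ 1 y) :=
      edgeOutcome_coneBase_coneSection w
    -- Adding the coboundary of `w` cancels `φ` on the tree, so the sum descends to the quotient.
    obtain ⟨ψ, hψ⟩ := exists_collapse_factorization (T := T)
      (edgeOutcome_degenerate (addNerve (coneBase X ≫ coneSection w) φ)) fun y hy => by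
        rw [edgeOutcome_addNerve, hs, hw y hy]
        exact CharTwo.add_self_eq_zero _
    have hsum : ∀ y, edgeOutcome φ y =
        edgeOutcome (coneBase X ≫ coneSection w) y + edgeOutcome (collapseMap T ≫ ψ) y := by
      intro y
      rw [hψ, edgeOutcome_addNerve, ← add_assoc, CharTwo.add_self_eq_zero, zero_add]
    have hψ' : ¬ IsCoboundary (edgeOutcome ψ) := by
      rintro ⟨u, hu⟩
      refine hφ ?_
      rw [funext hsum, isCoboundary_congr_add (isCoboundary_coneBase _)]
      exact ⟨fun v => u ((collapseMap T).app _ v), fun y => hu ((collapseMap T).app _ y)⟩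
    refine ⟨coneSection w, fairExt ψ, isVertex_fairExt (fun g _ v v' => ?_) hψ',
      fun h => hψ' (nonContextual_fairExt_iff.1 h), ?_⟩
    · rw [Subsingleton.elim v v']
    · rw [pullback_fairExt]
      exact (det_mul_eq_fairExt hsum).symm

end subcomplex

/-! ### The group `G_±` -/

section group

variable (X : SSet.{0})

/-- The coboundary homomorphism, with values in functions on the non-degenerate edges. -/
def edgeCoboundary : (X _⦋0⦌ → ZMod 2) →+ (X.nonDegenerate 1 → ZMod 2) where
  toFun w τ := w (X.δ 0 τ.1) - w (X.δ 1 τ.1)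
  map_zero' := funext fun _ => sub_self _
  map_add' _ _ := funext fun _ => add_sub_add_comm _ _ _ _

variable [X.HasDimensionLE 1]

variable {X}

theorem isCoboundary_ofNonDegenerate_iff (φ : X.nonDegenerate 1 → ZMod 2) :
    IsCoboundary (edgeOutcome (ofNonDegenerate φ)) ↔ φ ∈ (edgeCoboundary X).range := by
  constructor
  · rintro ⟨w, hw⟩
    exact ⟨w, funext fun τ => by rw [← edgeOutcome_ofNonDegenerate φ, hw]; rfl⟩
  · rintro ⟨w, rfl⟩
    refine ⟨w, fun y => ?_⟩
    by_cases hy : y ∈ X.nonDegenerate 1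
    · exact edgeOutcome_ofNonDegenerate _ ⟨y, hy⟩
    · rw [edgeOutcome_of_degenerate _ hy]
      obtain ⟨v, rfl⟩ := exists_vertex_of_degenerate hy
      rw [delta_one_sigma, delta_zero_sigma, sub_self]

theorem fairExt_ofNonDegenerate_injective :
    Function.Injective fun φ : X.nonDegenerate 1 → ZMod 2 => fairExt (ofNonDegenerate φ) := by
  intro φ ψ h
  funext τ
  rw [← edgeOutcome_ofNonDegenerate φ, ← edgeOutcome_ofNonDegenerate ψ]
  exact fairExt_eq_iff.1 h τ.1

theorem fairExt_eq_ofNonDegenerate (φ : X ⟶ NZ2) :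
    fairExt φ = fairExt (ofNonDegenerate fun τ => edgeOutcome φ τ.1) :=
  fairExt_eq_iff.2 (edgeOutcome_eq_of_nonDegenerate fun τ =>
    (edgeOutcome_ofNonDegenerate (fun τ => edgeOutcome φ τ.1) τ).symm)

theorem exists_eq_fairExt_of_mem_GPM
    (hX : ∀ v : X _⦋0⦌, ∃ τ ∈ X.nonDegenerate 1, X.δ 0 τ = v ∨ X.δ 1 τ = v)
    {p : SDist (cone X) NZ2} (hp : p ∈ GPM X) :
    ∃ φ : X.nonDegenerate 1 → ZMod 2, fairExt (ofNonDegenerate φ) = p := by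
  rw [mem_GPM_iff] at hp
  choose! b hb using hp
  refine ⟨fun τ => b τ.1, SDist.ext_nonDegenerate hX fun τ hτ => ?_⟩
  rw [tri_fairExt, hb τ hτ]
  exact congrArg fairTri (edgeOutcome_ofNonDegenerate (fun τ => b τ.1) ⟨τ, hτ⟩)

/-- The elements of `G_±` are classified by functions on the non-degenerate edges. -/
noncomputable def equivGPM
    (hX : ∀ v : X _⦋0⦌, ∃ τ ∈ X.nonDegenerate 1, X.δ 0 τ = v ∨ X.δ 1 τ = v) :
    Multiplicative (X.nonDegenerate 1 → ZMod 2) ≃ GPM X :=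
  Equiv.ofBijective (fun φ => ⟨fairExt (ofNonDegenerate φ.toAdd), fairExt_mem_GPM _⟩)
    ⟨fun _ _ h => fairExt_ofNonDegenerate_injective (congrArg Subtype.val h), fun p => by
      obtain ⟨φ, hφ⟩ := exists_eq_fairExt_of_mem_GPM hX p.2
      exact ⟨Multiplicative.ofAdd φ, Subtype.ext hφ⟩⟩

theorem coe_equivGPM (hX : ∀ v : X _⦋0⦌, ∃ τ ∈ X.nonDegenerate 1, X.δ 0 τ = v ∨ X.δ 1 τ = v)
    (φ : Multiplicative (X.nonDegenerate 1 → ZMod 2)) :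
    (equivGPM hX φ : SDist (cone X) NZ2) = fairExt (ofNonDegenerate φ.toAdd) :=
  rfl

theorem coe_equivGPM_mul
    (hX : ∀ v : X _⦋0⦌, ∃ τ ∈ X.nonDegenerate 1, X.δ 0 τ = v ∨ X.δ 1 τ = v)
    (φ ψ : Multiplicative (X.nonDegenerate 1 → ZMod 2)) :
    (equivGPM hX (φ * ψ) : SDist (cone X) NZ2) =
      SDist.mul (equivGPM hX φ).1 (equivGPM hX ψ).1 := by
  refine (fairExt_mul_eq (φ := ofNonDegenerate φ.toAdd) (ψ := ofNonDegenerate ψ.toAdd)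
    fun y => ?_).symm
  rw [← edgeOutcome_addNerve]
  refine edgeOutcome_eq_of_nonDegenerate (fun τ => ?_) y
  rw [edgeOutcome_addNerve, edgeOutcome_ofNonDegenerate, edgeOutcome_ofNonDegenerate,
    edgeOutcome_ofNonDegenerate]
  rfl

end group

/-! ### Counting -/

section counting

variable {X : SSet.{0}}

/-- Without loops or parallel edges, the non-degenerate edges correspond to those of the underlying
graph, a finite tree. -/
theorem card_tree_edges {Z : SSet.{0}} (hZ : IsTree Z) [Finite (Z _⦋0⦌)] :
    Nat.card (Z.nonDegenerate 1) + 1 = Nat.card (Z _⦋0⦌) := by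
  obtain ⟨_, hloop, hpar, hG⟩ := hZ
  rw [← (SimpleGraph.isTree_iff_connected_and_card.1 hG).2]
  congr 1
  refine Nat.card_congr (Equiv.ofBijective (fun τ => ⟨s(Z.δ 1 τ.1, Z.δ 0 τ.1),
    underlyingGraph_adj.2 ⟨hloop τ.1 τ.2, τ.1, rfl⟩⟩) ⟨fun τ τ' h => ?_, fun e => ?_⟩)
  · exact Subtype.ext (hpar _ τ.2 _ τ'.2 (congrArg Subtype.val h))
  · obtain ⟨e, he⟩ := e
    induction e using Sym2.ind with
    | _ v w =>
      obtain ⟨hne, τ, hτ⟩ := underlyingGraph_adj.1 he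
      refine ⟨⟨τ, fun hdeg => hne ?_⟩, Subtype.ext hτ⟩
      obtain ⟨u, rfl⟩ := exists_vertex_of_degenerate fun h => h hdeg
      rw [delta_one_sigma, delta_zero_sigma] at hτ
      rcases Sym2.eq_iff.1 hτ with ⟨h1, h2⟩ | ⟨h1, h2⟩
      · exact h1.symm.trans h2
      · exact h2.symm.trans h1

theorem ncard_maximalTree_edges {T : X.Subcomplex} (hT : IsMaximalTree T) [Finite (X _⦋0⦌)] :
    (X.nonDegenerate 1 ∩ T.obj (op ⦋1⦌)).ncard + 1 = Nat.card (X _⦋0⦌) := by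
  have : Finite (T.toSSet _⦋0⦌) :=
    Finite.of_injective (fun v : T.toSSet _⦋0⦌ => (v.1 : X _⦋0⦌)) Subtype.val_injective
  have h := card_tree_edges hT.1
  have h0 : Nat.card (T.toSSet _⦋0⦌) = Nat.card (X _⦋0⦌) :=
    Nat.card_congr (Equiv.ofBijective (fun v : T.toSSet _⦋0⦌ => (v.1 : X _⦋0⦌))
      ⟨Subtype.val_injective, fun v => ⟨⟨v, hT.2 v⟩, rfl⟩⟩)
  rw [← h0, ← h]
  congr 1
  refine (Nat.card_congr (Equiv.ofBijective
    (fun τ : T.toSSet.nonDegenerate 1 => (⟨τ.1.1, (T.mem_nonDegenerate_iff τ.1).1 τ.2, τ.1.2⟩ :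
      (X.nonDegenerate 1 ∩ T.obj (op ⦋1⦌) : Set _)))
    ⟨fun τ τ' h => ?_, fun τ => ?_⟩)).symm
  · exact Subtype.ext (Subtype.ext (Subtype.mk.inj h))
  · exact ⟨⟨⟨τ.1, τ.2.2⟩, (T.mem_nonDegenerate_iff ⟨τ.1, τ.2.2⟩).2 τ.2.1⟩, rfl⟩

/-- By connectedness the kernel consists of the two constants, so the image has half as many
elements as there are functions on vertices. -/
theorem card_range_edgeCoboundary [X.IsConnected] [Finite (X _⦋0⦌)] :
    Nat.card (edgeCoboundary X).range = 2 ^ (Nat.card (X _⦋0⦌) - 1) := by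
  obtain ⟨v₀⟩ : Nonempty (X _⦋0⦌) := inferInstance
  have hker : Nat.card (edgeCoboundary X).ker = 2 := by
    refine Eq.trans ?_ (Nat.card_zmod 2)
    refine Nat.card_congr (Equiv.ofBijective
      (fun w : (edgeCoboundary X).ker => w.1 v₀) ⟨fun w w' h => ?_, fun a => ?_⟩)
    · have hconst : ∀ (u : (edgeCoboundary X).ker) v, u.1 v = u.1 v₀ := fun u v =>
        eq_of_isConnected u.1 (fun y => by
          by_cases hy : y ∈ X.nonDegenerate 1
          · exact sub_eq_zero.1 (congrFun u.2 ⟨y, hy⟩)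
          · obtain ⟨x, rfl⟩ := exists_vertex_of_degenerate hy
            rw [delta_one_sigma, delta_zero_sigma]) v v₀
      refine Subtype.ext (funext fun v => ?_)
      rw [hconst w v, hconst w' v]
      exact h
    · exact ⟨⟨fun _ => a, funext fun _ => sub_self a⟩, rfl⟩
  have h := AddSubgroup.card_mul_index (edgeCoboundary X).ker
  rw [AddSubgroup.index_ker, hker, Nat.card_fun, Nat.card_zmod] at h
  obtain ⟨n, hn⟩ : ∃ n, Nat.card (X _⦋0⦌) = n + 1 :=
    Nat.exists_eq_succ_of_ne_zero (Nat.card_ne_zero.2 ⟨⟨v₀⟩, inferInstance⟩)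
  rw [hn, pow_succ'] at h
  rw [hn, Nat.add_sub_cancel]
  exact Nat.eq_of_mul_eq_mul_left two_pos h

theorem ncard_detectedVertices [X.HasDimensionLE 1] [X.IsConnected] [X.Finite] {T : X.Subcomplex}
    (hT : IsMaximalTree T) : (detectedVertices T).ncard =
      (2 ^ (X.nonDegenerate 1 \ T.obj (op ⦋1⦌)).ncard - 1) *
        2 ^ (Nat.card (X _⦋0⦌) - 1) := by
  obtain ⟨v₀⟩ : Nonempty (X _⦋0⦌) := inferInstance
  have himage : detectedVertices T =
      (fun φ : X.nonDegenerate 1 → ZMod 2 => fairExt (ofNonDegenerate φ)) ''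
        ((edgeCoboundary X).range : Set (X.nonDegenerate 1 → ZMod 2))ᶜ := by
    ext p
    rw [mem_detectedVertices_iff v₀ hT]
    constructor
    · rintro ⟨φ, hφ, rfl⟩
      refine ⟨fun τ => edgeOutcome φ τ.1, fun hmem => hφ ?_, (fairExt_eq_ofNonDegenerate φ).symm⟩
      rw [← nonContextual_fairExt_iff, fairExt_eq_ofNonDegenerate, nonContextual_fairExt_iff]
      exact (isCoboundary_ofNonDegenerate_iff _).2 hmem
    · rintro ⟨φ, hφ, rfl⟩
      exact ⟨_, fun h => hφ ((isCoboundary_ofNonDegenerate_iff φ).1 h), rfl⟩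
  have hrange : ((edgeCoboundary X).range : Set (X.nonDegenerate 1 → ZMod 2)).ncard =
      2 ^ (Nat.card (X _⦋0⦌) - 1) := card_range_edgeCoboundary
  have hedges : (X.nonDegenerate 1 ∩ T.obj (op ⦋1⦌)).ncard +
      (X.nonDegenerate 1 \ T.obj (op ⦋1⦌)).ncard = Nat.card (X.nonDegenerate 1) :=
    (Set.ncard_inter_add_ncard_sdiff_eq_ncard (X.nonDegenerate 1) (T.obj (op ⦋1⦌))
      (Set.toFinite _))
  have htree := ncard_maximalTree_edges hT
  -- Cochains minus coboundaries; the exponent of the first power splits into the edges outside `T`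
  -- and the V - 1 edges of `T`.
  rw [himage, Set.ncard_image_of_injective _ fairExt_ofNonDegenerate_injective, Set.ncard_compl,
    hrange, Nat.card_fun, Nat.card_zmod, ← hedges, ← htree, Nat.add_sub_cancel, Nat.sub_mul,
    one_mul, ← pow_add, add_comm]

end counting

end SimplicialContextuality

/-! ### The main theorem -/

open SimplicialContextuality
theorem mainTheorem10 (X : SSet.{0}) [X.HasDimensionLE 1]
    (hX : ∀ v : X.obj (op (SimplexCategory.mk 0)),
      ∃ τ ∈ X.nonDegenerate 1, X.δ 0 τ = v ∨ X.δ 1 τ = v) :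
    ∃ e : SDist (cone X) NZ2,
      (∀ p : SDist (cone X) NZ2,
        p = e ↔ ∀ τ ∈ X.nonDegenerate 1, p.at (coneTriangle τ) = pPlus) ∧
      (∃ _ : CommGroup (GPM X),
        (∀ p q : GPM X, ((p * q : GPM X) : SDist (cone X) NZ2) = SDist.mul p.1 q.1) ∧
        ((1 : GPM X) : SDist (cone X) NZ2) = e ∧
        Nonempty (GPM X ≃* Multiplicative (X.nonDegenerate 1 → ZMod 2)) ∧
        ∃ H : Subgroup (GPM X), Subtype.val '' (H : Set (GPM X)) = detOrbit e) ∧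
      (∀ p ∈ GPM X, p.NonContextual ↔ p ∈ detOrbit e) ∧
      (X.IsConnected →
        (∀ p ∈ GPM X \ detOrbit e, p.Contextual ∧ p.IsVertex) ∧
        ∀ T : X.Subcomplex, IsMaximalTree T →
          GPM X \ detOrbit e = detectedVertices T ∧
          (X.Finite →
            (detectedVertices T).ncard =
              (2 ^ {τ ∈ X.nonDegenerate 1 | τ ∉ T.obj (op (SimplexCategory.mk 1))}.ncard - 1) *
                2 ^ (Nat.card (X.obj (op (SimplexCategory.mk 0))) - 1))) := by
  have hzero : ∀ y, edgeOutcome (ofNonDegenerate (X := X) 0) y = 0 := fun y => by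
    by_cases hy : y ∈ X.nonDegenerate 1
    · exact edgeOutcome_ofNonDegenerate 0 ⟨y, hy⟩
    · exact edgeOutcome_of_degenerate _ hy
  have hdiff : ∀ p, p ∈ GPM X \ detOrbit (fairExt (ofNonDegenerate 0)) ↔
      ∃ φ : X ⟶ NZ2, ¬ IsCoboundary (edgeOutcome φ) ∧ p = fairExt φ := by
    intro p
    constructor
    · rintro ⟨hp, hp'⟩
      obtain ⟨φ, rfl⟩ := exists_eq_fairExt_of_mem_GPM hX hp
      exact ⟨_, fun h => hp' ((fairExt_mem_detOrbit_iff hzero).2 h), rfl⟩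
    · rintro ⟨φ, hφ, rfl⟩
      exact ⟨fairExt_mem_GPM φ, fun h => hφ ((fairExt_mem_detOrbit_iff hzero).1 h)⟩
  refine ⟨fairExt (ofNonDegenerate 0), fun p => ⟨?_, fun h => ?_⟩, ?_, fun p hp => ?_,
    fun hconn => ⟨fun p hp => ?_, fun T hT => ⟨?_, fun _ => ncard_detectedVertices hT⟩⟩⟩
  · rintro rfl τ _
    rw [at_eq_pPlus_iff, tri_fairExt, hzero]
  · refine SDist.ext_nonDegenerate hX fun τ hτ => ?_
    rw [(at_eq_pPlus_iff p τ).1 (h τ hτ), tri_fairExt, hzero]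
  -- The group structure is transported from the cochains; `coe_equivGPM_mul` shows that it is the
  -- convolution product. The subgroup `H` is that of the coboundaries.
  · let G : CommGroup (GPM X) := (equivGPM hX).symm.commGroup
    let f : GPM X ≃* Multiplicative (X.nonDegenerate 1 → ZMod 2) := (equivGPM hX).symm.mulEquiv
    have hf : ∀ p, equivGPM hX (f p) = p := (equivGPM hX).apply_symm_apply
    refine ⟨G, fun p q => ?_, rfl, ⟨f⟩,
      (AddSubgroup.toSubgroup (edgeCoboundary X).range).comap f.toMonoidHom, ?_⟩
    · rw [← hf (p * q), map_mul, coe_equivGPM_mul, hf, hf]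
    · ext p
      constructor
      · rintro ⟨p, hp, rfl⟩
        rw [← hf p, coe_equivGPM, fairExt_mem_detOrbit_iff hzero,
          isCoboundary_ofNonDegenerate_iff]
        exact hp
      · intro hp
        have hmem : p ∈ GPM X := by
          obtain ⟨s, rfl⟩ := hp
          rw [mul_det_eq_fairExt (ψ := coneBase X ≫ s) fun y => by rw [hzero, zero_add]]
          exact fairExt_mem_GPM _
        refine ⟨⟨p, hmem⟩, ?_, rfl⟩
        have h : ((equivGPM hX (f ⟨p, hmem⟩) : GPM X) : SDist (cone X) NZ2) = p :=
          congrArg Subtype.val (hf ⟨p, hmem⟩)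
        rw [← h, coe_equivGPM, fairExt_mem_detOrbit_iff hzero,
          isCoboundary_ofNonDegenerate_iff] at hp
        exact hp
  · obtain ⟨φ, rfl⟩ := exists_eq_fairExt_of_mem_GPM hX hp
    rw [nonContextual_fairExt_iff, fairExt_mem_detOrbit_iff hzero]
  · obtain ⟨φ, hφ, rfl⟩ := (hdiff p).1 hp
    exact ⟨fun h => hφ (nonContextual_fairExt_iff.1 h),
      isVertex_fairExt (fun g hg => eq_of_isConnected g hg) hφ⟩
  · ext p
    obtain ⟨v₀⟩ : Nonempty (X.obj (op (SimplexCategory.mk 0))) := inferInstance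
    rw [hdiff, mem_detectedVertices_iff v₀ hT]
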